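/- Let $k$ be a commutative artinian ring, let $A$ and $B$ be artin $k$-algebras, and let $M$ be a $B$-$A$-bimodule, finitely generated over $k$ and with $k$ acting centrally, so that $\Lambda=\begin{bmatrix}B&M\\0&A\end{bmatrix}$ is an artin $k$-algebra. All modules are finitely generated left modules unless said otherwise. Let $D=\operatorname{Hom}_k(-,E)$, where $E$ is the injective envelope of $k/\operatorname{rad}k$. For an artin algebra $R$ put ${}^{\perp}R=\{X\mid \operatorname{Ext}^i_R(X,R)=0 \text{ for all } i\ge 1\}$ and $({}^{\perp}R)^{\perp}=\{Z\mid \operatorname{Ext}^i_R(X,Z)=0 \text{ for all } X\in{}^{\perp}R \text{ and all } i\ge 1\}$. Let $\operatorname{Gproj}(R)$ be the class of Gorenstein-projective $R$-modules, that is, of modules isomorphic to $\operatorname{Ker}(P^0\to P^1)$ for some exact sequence $\cdots\to P^{-1}\to P^0\to P^1\to\cdots$ of finitely generated projective $R$-modules that stays exact under $\operatorname{Hom}_R(-,R)$. The algebra $R$ is called left weakly Gorenstein if $\operatorname{Gproj}(R)={}^{\perp}R$. A triple $(X,Y,\varphi)$, consisting of a $B$-module $X$, an $A$-module $Y$ and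 a $B$-homomorphism $\varphi\colon M\otimes_AY\to X$, is regarded as the $\Lambda$-module of column vectors $\begin{bmatrix}x\\y\end{bmatrix}$ with $\begin{bmatrix}b&m\\0&a\end{bmatrix}\begin{bmatrix}x\\y\end{bmatrix}=\begin{bmatrix}bx+\varphi(m\otimes y)\\ay\end{bmatrix}$. **Lemma.** Assume that $A$ and $B$ are left weakly Gorenstein, that the left $B$-module $M$ has finite projective dimension, and that the left $A$-module $D(M_A)$ belongs to $({}^{\perp}A)^{\perp}$. Then a $\Lambda$-module $(X,Y,\varphi)$ lies in ${}^{\perp}\Lambda$ if and only if $\varphi$ is a monomorphism, $\operatorname{Coker}\varphi\in\operatorname{Gproj}(B)$ and $Y\in\operatorname{Gproj}(A)$. -/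

import Mathlib

open scoped TensorProduct

universe u

/-! ### Semi-Gorenstein-projective and Gorenstein-projective modules -/

section Gorenstein

variable (R : Type u) [Ring R]

/-- `X ∈ ⊥R`: `X` is a finitely generated left `R`-module with `Ext^i_R(X, R) = 0` for `i ≥ 1`. -/
def IsSemiGorensteinProjective (X : Type u) [AddCommGroup X] [Module R X] : Prop :=
  Module.Finite R X ∧
    ∀ i : ℕ, 1 ≤ i →
      Subsingleton (CategoryTheory.Abelian.Ext (ModuleCat.of R X) (ModuleCat.of R R) i)

/-- The vanishing condition defining `(⊥R)^⊥`: `Ext^i_R(X, Z) = 0` for all `X ∈ ⊥R` and all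
`i ≥ 1`. -/
def InRightPerpOfSemiGorensteinProjective (Z : Type u) [AddCommGroup Z] [Module R Z] : Prop :=
  ∀ (X : Type u) [AddCommGroup X] [Module R X], IsSemiGorensteinProjective R X →
    ∀ i : ℕ, 1 ≤ i →
      Subsingleton (CategoryTheory.Abelian.Ext (ModuleCat.of R X) (ModuleCat.of R Z) i)

/-- A complete projective resolution over `R`: a doubly infinite exact sequence
`⋯ → P i → P (i + 1) → ⋯` of finitely generated projective left `R`-modules which remains exact
under `Hom_R(-, R)`. -/
structure CompleteProjectiveResolution where
  /-- the modules of the sequence -/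
  P : ℤ → ModuleCat.{u} R
  /-- the differentials -/
  d : ∀ i : ℤ, P i →ₗ[R] P (i + 1)
  finite : ∀ i : ℤ, Module.Finite R (P i)
  projective : ∀ i : ℤ, Module.Projective R (P i)
  exact : ∀ i : ℤ, Function.Exact (d i) (d (i + 1))
  /-- `Hom(P (i + 2), R) → Hom(P (i + 1), R) → Hom(P i, R)` is exact (that the composite is zero
  already follows from `exact`) -/
  hom_exact : ∀ (i : ℤ) (f : P (i + 1) →ₗ[R] R), f ∘ₗ d i = 0 →
    ∃ g : P (i + 1 + 1) →ₗ[R] R, g ∘ₗ d (i + 1) = f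

/-- `G ∈ Gproj(R)`: the left `R`-module `G` is a (necessarily finitely generated)
Gorenstein-projective module, i.e. a kernel in a complete projective resolution. -/
def IsGorensteinProjective (G : Type u) [AddCommGroup G] [Module R G] : Prop :=
  ∃ T : CompleteProjectiveResolution R, Nonempty (G ≃ₗ[R] LinearMap.ker (T.d 0))

/-- `R` is left weakly Gorenstein: `Gproj(R) = ⊥R` as classes of left `R`-modules. -/
def IsLeftWeaklyGorenstein : Prop :=
  ∀ (X : Type u) [AddCommGroup X] [Module R X],
    IsGorensteinProjective R X ↔ IsSemiGorensteinProjective R X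

end Gorenstein

/-! ### The duality of an artin algebra -/

/-- `ι : N → E` is an injective envelope: `E` is injective, `ι` is a monomorphism and its image is
an essential submodule of `E`. -/
structure IsInjectiveEnvelope {k N E : Type u} [CommRing k] [AddCommGroup N] [Module k N]
    [AddCommGroup E] [Module k E] (ι : N →ₗ[k] E) : Prop where
  injective_module : Module.Injective k E
  injective : Function.Injective ι
  essential : ∀ S : Submodule k E, S ⊓ LinearMap.range ι = ⊥ → S = ⊥

/-- `D(M) = Hom_k(M, E)`. For `E` the injective envelope of `k / rad k` this is the usual duality
for artin `k`-algebras. -/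
def ArtinDual (k M E : Type u) [CommRing k] [AddCommGroup M] [Module k M]
    [AddCommGroup E] [Module k E] : Type u :=
  M →ₗ[k] E

namespace ArtinDual

variable (k M E : Type u) [CommRing k] [AddCommGroup M] [Module k M]
  [AddCommGroup E] [Module k E]

instance : AddCommGroup (ArtinDual k M E) := inferInstanceAs (AddCommGroup (M →ₗ[k] E))

/-- For a right `A`-module `M` (a left module over the opposite ring), `D(M)` is a left `A`-module
through `(a • f)(m) = f(m a)`. -/
instance (A : Type u) [Ring A] [Algebra k A] [Module Aᵐᵒᵖ M] [IsScalarTower k Aᵐᵒᵖ M] :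
    Module A (ArtinDual k M E) where
  smul a f := LinearMap.comp (show M →ₗ[k] E from f)
    (DistribSMul.toLinearMap k M (MulOpposite.op a))
  one_smul f := LinearMap.ext fun m =>
    congrArg (show M →ₗ[k] E from f) (one_smul Aᵐᵒᵖ m)
  mul_smul a b f := LinearMap.ext fun m =>
    congrArg (show M →ₗ[k] E from f) (mul_smul (MulOpposite.op b) (MulOpposite.op a) m)
  smul_zero _ := rfl
  smul_add _ _ _ := rfl
  add_smul a b f := LinearMap.ext fun m =>
    (congrArg (show M →ₗ[k] E from f)
      (add_smul (MulOpposite.op a) (MulOpposite.op b) m)).trans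
      (map_add (show M →ₗ[k] E from f) _ _)
  zero_smul f := LinearMap.ext fun m =>
    (congrArg (show M →ₗ[k] E from f) (zero_smul Aᵐᵒᵖ m)).trans
      (map_zero (show M →ₗ[k] E from f))

end ArtinDual

/-! ### The tensor product of a bimodule with a left module -/

section BimodTensor

variable (B M A Y : Type u) [Ring B] [Ring A] [AddCommGroup M] [Module B M] [Module Aᵐᵒᵖ M]
  [AddCommGroup Y] [Module A Y]

/-- The relations `m a ⊗ y = m ⊗ a y`. For a `B`-`A`-bimodule `M` the set of generators is
stable under `B`, so its `B`-span is the subgroup that it generates. -/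
def bimodTensorRelations : Submodule B (M ⊗[ℤ] Y) :=
  Submodule.span B {t | ∃ (m : M) (a : A) (y : Y),
    t = (MulOpposite.op a • m) ⊗ₜ[ℤ] y - m ⊗ₜ[ℤ] (a • y)}

/-- `M ⊗_A Y` as a left `B`-module, for a `B`-`A`-bimodule `M` and a left `A`-module `Y`. -/
abbrev BimodTensor : Type u :=
  (M ⊗[ℤ] Y) ⧸ bimodTensorRelations B M A Y

variable {M Y}

/-- The element `m ⊗ y` of `M ⊗_A Y`. -/
def bimodTmul (m : M) (y : Y) : BimodTensor B M A Y :=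
  (bimodTensorRelations B M A Y).mkQ (m ⊗ₜ[ℤ] y)

theorem bimodTmul_add (m : M) (y y' : Y) :
    bimodTmul B A m (y + y') = bimodTmul B A m y + bimodTmul B A m y' := by
  simp [bimodTmul, TensorProduct.tmul_add]

theorem add_bimodTmul (m m' : M) (y : Y) :
    bimodTmul B A (m + m') y = bimodTmul B A m y + bimodTmul B A m' y := by
  simp [bimodTmul, TensorProduct.add_tmul]

theorem bimodTmul_zero (m : M) : bimodTmul B A m (0 : Y) = 0 := by
  simp [bimodTmul]

theorem zero_bimodTmul (y : Y) : bimodTmul B A (0 : M) y = 0 := by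
  simp [bimodTmul]

theorem smul_bimodTmul (b : B) (m : M) (y : Y) :
    bimodTmul B A (b • m) y = b • bimodTmul B A m y := rfl

theorem op_smul_bimodTmul (a : A) (m : M) (y : Y) :
    bimodTmul B A (MulOpposite.op a • m) y = bimodTmul B A m (a • y) :=
  (Submodule.Quotient.eq _).2 (Submodule.subset_span ⟨m, a, y, rfl⟩)

end BimodTensor

/-! ### The triangular matrix ring and its modules -/

/-- The matrices with rows `(b, m)` and `(0, a)`. -/
@[ext]
structure TriangularMatrixRing (B M A : Type u) : Type u where
  /-- the upper left entry -/
  b : B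
  /-- the upper right entry -/
  m : M
  /-- the lower right entry -/
  a : A

namespace TriangularMatrixRing

variable {B M A : Type u} [Ring B] [Ring A] [AddCommGroup M]

instance : Zero (TriangularMatrixRing B M A) := ⟨⟨0, 0, 0⟩⟩
instance : One (TriangularMatrixRing B M A) := ⟨⟨1, 0, 1⟩⟩
instance : Add (TriangularMatrixRing B M A) := ⟨fun s t => ⟨s.b + t.b, s.m + t.m, s.a + t.a⟩⟩
instance : Neg (TriangularMatrixRing B M A) := ⟨fun s => ⟨-s.b, -s.m, -s.a⟩⟩

@[simp] theorem zero_b : (0 : TriangularMatrixRing B M A).b = 0 := rfl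
@[simp] theorem zero_m : (0 : TriangularMatrixRing B M A).m = 0 := rfl
@[simp] theorem zero_a : (0 : TriangularMatrixRing B M A).a = 0 := rfl
@[simp] theorem one_b : (1 : TriangularMatrixRing B M A).b = 1 := rfl
@[simp] theorem one_m : (1 : TriangularMatrixRing B M A).m = 0 := rfl
@[simp] theorem one_a : (1 : TriangularMatrixRing B M A).a = 1 := rfl
@[simp] theorem add_b (s t : TriangularMatrixRing B M A) : (s + t).b = s.b + t.b := rfl
@[simp] theorem add_m (s t : TriangularMatrixRing B M A) : (s + t).m = s.m + t.m := rfl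
@[simp] theorem add_a (s t : TriangularMatrixRing B M A) : (s + t).a = s.a + t.a := rfl
@[simp] theorem neg_b (s : TriangularMatrixRing B M A) : (-s).b = -s.b := rfl
@[simp] theorem neg_m (s : TriangularMatrixRing B M A) : (-s).m = -s.m := rfl
@[simp] theorem neg_a (s : TriangularMatrixRing B M A) : (-s).a = -s.a := rfl

variable [Module B M] [Module Aᵐᵒᵖ M]

/-- Matrix multiplication. -/
instance : Mul (TriangularMatrixRing B M A) :=
  ⟨fun s t => ⟨s.b * t.b, s.b • t.m + MulOpposite.op t.a • s.m, s.a * t.a⟩⟩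

@[simp] theorem mul_b (s t : TriangularMatrixRing B M A) : (s * t).b = s.b * t.b := rfl
@[simp] theorem mul_m (s t : TriangularMatrixRing B M A) :
    (s * t).m = s.b • t.m + MulOpposite.op t.a • s.m := rfl
@[simp] theorem mul_a (s t : TriangularMatrixRing B M A) : (s * t).a = s.a * t.a := rfl

instance [SMulCommClass B Aᵐᵒᵖ M] : Ring (TriangularMatrixRing B M A) where
  add_assoc r s t := by ext <;> simp [add_assoc]
  zero_add s := by ext <;> simp
  add_zero s := by ext <;> simp
  add_comm s t := by ext <;> simp [add_comm]
  neg_add_cancel s := by ext <;> simp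
  mul_assoc r s t := by
    ext <;> simp [mul_assoc, mul_smul, smul_add, add_assoc, smul_comm]
  one_mul s := by ext <;> simp
  mul_one s := by ext <;> simp
  zero_mul s := by ext <;> simp
  mul_zero s := by ext <;> simp
  left_distrib r s t := by
    ext <;> simp [mul_add, add_smul, add_add_add_comm]
  right_distrib r s t := by
    ext <;> simp [add_mul, add_smul, add_add_add_comm]
  nsmul := nsmulRec
  zsmul := zsmulRec

end TriangularMatrixRing

/-- The left module over the triangular matrix ring given by a triple `(X, Y, φ)`, where
`φ : M ⊗_A Y → X` is `B`-linear. Its elements are the column vectors `(x, y)`. -/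
@[ext]
structure TripleModule {B M A X Y : Type u} [Ring B] [Ring A] [AddCommGroup M] [Module B M]
    [Module Aᵐᵒᵖ M] [SMulCommClass B Aᵐᵒᵖ M] [AddCommGroup X] [Module B X]
    [AddCommGroup Y] [Module A Y] (φ : BimodTensor B M A Y →ₗ[B] X) : Type u where
  /-- the upper entry -/
  x : X
  /-- the lower entry -/
  y : Y

namespace TripleModule

variable {B M A X Y : Type u} [Ring B] [Ring A] [AddCommGroup M] [Module B M]
  [Module Aᵐᵒᵖ M] [SMulCommClass B Aᵐᵒᵖ M] [AddCommGroup X] [Module B X]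
  [AddCommGroup Y] [Module A Y] {φ : BimodTensor B M A Y →ₗ[B] X}

instance : Zero (TripleModule φ) := ⟨⟨0, 0⟩⟩
instance : Add (TripleModule φ) := ⟨fun v w => ⟨v.x + w.x, v.y + w.y⟩⟩
instance : Neg (TripleModule φ) := ⟨fun v => ⟨-v.x, -v.y⟩⟩

/-- The matrix with rows `(b, m)` and `(0, a)` sends `(x, y)` to `(b x + φ(m ⊗ y), a y)`. -/
instance : SMul (TriangularMatrixRing B M A) (TripleModule φ) :=
  ⟨fun t v => ⟨t.b • v.x + φ (bimodTmul B A t.m v.y), t.a • v.y⟩⟩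

@[simp] theorem zero_x : (0 : TripleModule φ).x = 0 := rfl
@[simp] theorem zero_y : (0 : TripleModule φ).y = 0 := rfl
@[simp] theorem add_x (v w : TripleModule φ) : (v + w).x = v.x + w.x := rfl
@[simp] theorem add_y (v w : TripleModule φ) : (v + w).y = v.y + w.y := rfl
@[simp] theorem neg_x (v : TripleModule φ) : (-v).x = -v.x := rfl
@[simp] theorem neg_y (v : TripleModule φ) : (-v).y = -v.y := rfl
@[simp] theorem smul_x (t : TriangularMatrixRing B M A) (v : TripleModule φ) :
    (t • v).x = t.b • v.x + φ (bimodTmul B A t.m v.y) := rfl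
@[simp] theorem smul_y (t : TriangularMatrixRing B M A) (v : TripleModule φ) :
    (t • v).y = t.a • v.y := rfl

instance : AddCommGroup (TripleModule φ) where
  add_assoc u v w := by ext <;> simp [add_assoc]
  zero_add v := by ext <;> simp
  add_zero v := by ext <;> simp
  add_comm v w := by ext <;> simp [add_comm]
  neg_add_cancel v := by ext <;> simp
  nsmul := nsmulRec
  zsmul := zsmulRec

instance : Module (TriangularMatrixRing B M A) (TripleModule φ) where
  one_smul v := by ext <;> simp [zero_bimodTmul]
  mul_smul s t v := by
    ext <;> simp [mul_smul, add_bimodTmul, smul_bimodTmul, op_smul_bimodTmul, add_assoc]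
  smul_zero t := by ext <;> simp [bimodTmul_zero]
  smul_add t v w := by ext <;> simp [bimodTmul_add, add_add_add_comm]
  add_smul s t v := by ext <;> simp [add_smul, add_bimodTmul, add_add_add_comm]
  zero_smul v := by ext <;> simp [zero_bimodTmul]

end TripleModule

/-! ### Vanishing of `Ext` groups of modules -/

section ExtLongExactSequence

open CategoryTheory CategoryTheory.Abelian

universe v w

variable {C : Type v} [Category.{w} C] [Abelian C] [HasExt.{u} C] {S : ShortComplex C}

theorem subsingleton_ext_of_forall_eq_zero {X Y : C} {n : ℕ} (h : ∀ x : Ext X Y n, x = 0) :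
    Subsingleton (Ext X Y n) :=
  ⟨fun x y => (h x).trans (h y).symm⟩

theorem CategoryTheory.ShortComplex.ShortExact.exists_extension_of_subsingleton_ext
    (hS : S.ShortExact) {Y : C} [hY : Subsingleton (Ext S.X₃ Y 1)] (h : S.X₁ ⟶ Y) :
    ∃ h' : S.X₂ ⟶ Y, S.f ≫ h' = h := by
  obtain ⟨x₂, hx₂⟩ := Ext.contravariant_sequence_exact₁ hS Y (Ext.mk₀ h) (n₁ := 1) rfl
    (hY.elim _ _)
  obtain ⟨h', rfl⟩ := (Ext.mk₀_bijective _ _).2 x₂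
  refine ⟨h', (Ext.mk₀_bijective _ _).1 ?_⟩
  rw [← hx₂, Ext.mk₀_comp_mk₀]

theorem CategoryTheory.ShortComplex.ShortExact.exists_lift_of_subsingleton_ext
    (hS : S.ShortExact) {X : C} [hX : Subsingleton (Ext X S.X₁ 1)] (h : X ⟶ S.X₃) :
    ∃ h' : X ⟶ S.X₂, h' ≫ S.g = h := by
  obtain ⟨x₂, hx₂⟩ := Ext.covariant_sequence_exact₃ X hS (Ext.mk₀ h) (n₁ := 1) rfl
    (hX.elim _ _)
  obtain ⟨h', rfl⟩ := (Ext.mk₀_bijective _ _).2 x₂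
  refine ⟨h', (Ext.mk₀_bijective _ _).1 ?_⟩
  rw [← hx₂, Ext.mk₀_comp_mk₀]

theorem CategoryTheory.ShortComplex.ShortExact.subsingleton_ext_X₁_left
    (hS : S.ShortExact) {Y : C} {i j : ℕ} (hij : 1 + i = j) [h2 : Subsingleton (Ext S.X₂ Y i)]
    [h3 : Subsingleton (Ext S.X₃ Y j)] : Subsingleton (Ext S.X₁ Y i) :=
  subsingleton_ext_of_forall_eq_zero fun x => by
    obtain ⟨y, rfl⟩ := Ext.contravariant_sequence_exact₁ hS Y x hij (h3.elim _ _)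
    rw [h2.elim y 0, Ext.comp_zero]

theorem CategoryTheory.ShortComplex.ShortExact.subsingleton_ext_X₃_left
    (hS : S.ShortExact) {Y : C} {i j : ℕ} (hij : 1 + i = j) [h1 : Subsingleton (Ext S.X₁ Y i)]
    [h2 : Subsingleton (Ext S.X₂ Y j)] : Subsingleton (Ext S.X₃ Y j) :=
  subsingleton_ext_of_forall_eq_zero fun x => by
    obtain ⟨y, rfl⟩ := Ext.contravariant_sequence_exact₃ hS Y x (h2.elim _ _) hij
    rw [h1.elim y 0, Ext.comp_zero]

theorem CategoryTheory.ShortComplex.ShortExact.subsingleton_ext_one_left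
    (hS : S.ShortExact) {Y : C} (h1 : ∀ h : S.X₁ ⟶ Y, ∃ h' : S.X₂ ⟶ Y, S.f ≫ h' = h)
    [h2 : Subsingleton (Ext S.X₂ Y 1)] : Subsingleton (Ext S.X₃ Y 1) :=
  subsingleton_ext_of_forall_eq_zero fun x => by
    obtain ⟨y, rfl⟩ := Ext.contravariant_sequence_exact₃ hS Y x (h2.elim _ _) (n₀ := 0) rfl
    obtain ⟨h, rfl⟩ := (Ext.mk₀_bijective _ _).2 y
    obtain ⟨h', rfl⟩ := h1 h
    rw [← Ext.mk₀_comp_mk₀, hS.extClass_comp_assoc]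

theorem CategoryTheory.ShortComplex.ShortExact.subsingleton_ext_X₂_right
    (hS : S.ShortExact) {X : C} {i : ℕ} [h1 : Subsingleton (Ext X S.X₁ i)]
    [h3 : Subsingleton (Ext X S.X₃ i)] : Subsingleton (Ext X S.X₂ i) :=
  subsingleton_ext_of_forall_eq_zero fun x => by
    obtain ⟨y, rfl⟩ := Ext.covariant_sequence_exact₂ X hS x (h3.elim _ _)
    rw [h1.elim y 0, Ext.zero_comp]

theorem CategoryTheory.ShortComplex.ShortExact.subsingleton_ext_X₃_right
    (hS : S.ShortExact) {X : C} {i : ℕ} [h1 : Subsingleton (Ext X S.X₁ (i + 1))]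
    [h2 : Subsingleton (Ext X S.X₂ i)] : Subsingleton (Ext X S.X₃ i) :=
  subsingleton_ext_of_forall_eq_zero fun x => by
    obtain ⟨y, rfl⟩ := Ext.covariant_sequence_exact₃ X hS x rfl (h1.elim _ _)
    rw [h2.elim y 0, Ext.zero_comp]

theorem CategoryTheory.ShortComplex.ShortExact.subsingleton_ext_X₁_right
    (hS : S.ShortExact) {X : C} {i : ℕ} [h2 : Subsingleton (Ext X S.X₂ (i + 1))]
    [h3 : Subsingleton (Ext X S.X₃ i)] : Subsingleton (Ext X S.X₁ (i + 1)) :=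
  subsingleton_ext_of_forall_eq_zero fun x => by
    obtain ⟨y, rfl⟩ := Ext.covariant_sequence_exact₁ X hS x (h2.elim _ _) rfl
    rw [h3.elim y 0, Ext.zero_comp]

theorem CategoryTheory.ShortComplex.ShortExact.subsingleton_ext_one_right
    (hS : S.ShortExact) {X : C} (h3 : ∀ h : X ⟶ S.X₃, ∃ h' : X ⟶ S.X₂, h' ≫ S.g = h)
    [h2 : Subsingleton (Ext X S.X₂ 1)] : Subsingleton (Ext X S.X₁ 1) :=
  subsingleton_ext_of_forall_eq_zero fun x => by
    obtain ⟨y, rfl⟩ := Ext.covariant_sequence_exact₁ X hS x (h2.elim _ _) (n₀ := 0) rfl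
    obtain ⟨h, rfl⟩ := (Ext.mk₀_bijective _ _).2 y
    obtain ⟨h', rfl⟩ := h3 h
    rw [← Ext.mk₀_comp_mk₀, Ext.comp_assoc_of_second_deg_zero, hS.comp_extClass, Ext.comp_zero]

end ExtLongExactSequence

section ExtVanishing

open CategoryTheory CategoryTheory.Abelian

variable (R : Type u) [Ring R]

/-- `Ext^i_R(X, W) = 0` for `1 ≤ i ≤ n`. -/
def ExtVanishesUpTo (n : ℕ) (X W : Type u) [AddCommGroup X] [Module R X] [AddCommGroup W]
    [Module R W] : Prop :=
  ∀ i : ℕ, 1 ≤ i → i ≤ n → Subsingleton (Ext (ModuleCat.of R X) (ModuleCat.of R W) i)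

/-- `Ext^i_R(X, W) = 0` for `1 ≤ i`. -/
def ExtVanishes (X W : Type u) [AddCommGroup X] [Module R X] [AddCommGroup W]
    [Module R W] : Prop :=
  ∀ i : ℕ, 1 ≤ i → Subsingleton (Ext (ModuleCat.of R X) (ModuleCat.of R W) i)

variable {R}
variable {X W K P W₁ W₂ W₃ : Type u} [AddCommGroup X] [Module R X] [AddCommGroup W] [Module R W]
  [AddCommGroup K] [Module R K] [AddCommGroup P] [Module R P]
  [AddCommGroup W₁] [Module R W₁] [AddCommGroup W₂] [Module R W₂] [AddCommGroup W₃] [Module R W₃]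

theorem extVanishes_iff_forall_upTo :
    ExtVanishes R X W ↔ ∀ n, ExtVanishesUpTo R n X W :=
  ⟨fun h _ i hi _ => h i hi, fun h i hi => h i i hi le_rfl⟩

/-- The short complex of modules given by an exact pair of linear maps. -/
def moduleShortComplex (f : K →ₗ[R] P) (g : P →ₗ[R] X) (hfg : Function.Exact f g) :
    ShortComplex (ModuleCat.{u} R) :=
  ShortComplex.mk (ModuleCat.ofHom f) (ModuleCat.ofHom g) (by
    ext x
    exact (hfg (f x)).2 ⟨x, rfl⟩)

theorem moduleShortComplex_shortExact (f : K →ₗ[R] P) (g : P →ₗ[R] X)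
    (hf : Function.Injective f) (hfg : Function.Exact f g) (hg : Function.Surjective g) :
    (moduleShortComplex f g hfg).ShortExact where
  exact := (ShortComplex.ShortExact.moduleCat_exact_iff_function_exact _).2 hfg
  mono_f := (ModuleCat.mono_iff_injective _).2 hf
  epi_g := (ModuleCat.epi_iff_surjective _).2 hg

theorem extVanishesUpTo_succ_iff [Module.Projective R P] (f : K →ₗ[R] P) (g : P →ₗ[R] X)
    (hf : Function.Injective f) (hfg : Function.Exact f g) (hg : Function.Surjective g) (n : ℕ) :
    ExtVanishesUpTo R (n + 1) X W ↔
      (∀ h : K →ₗ[R] W, ∃ h' : P →ₗ[R] W, h' ∘ₗ f = h) ∧ ExtVanishesUpTo R n K W := by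
  have hS := moduleShortComplex_shortExact f g hf hfg hg
  have hP : Projective (ModuleCat.of R P) := (IsProjective.iff_projective P).1 inferInstance
  have hP' : ∀ i, 1 ≤ i → Subsingleton
      (Ext (moduleShortComplex f g hfg).X₂ (ModuleCat.of R W) i) := fun i hi => by
    obtain ⟨j, rfl⟩ : ∃ j, i = j + 1 := ⟨i - 1, by omega⟩
    exact Ext.subsingleton_of_projective (ModuleCat.of R P) _ j
  constructor
  · intro H
    refine ⟨fun h => ?_, fun i hi hin => ?_⟩
    · have : Subsingleton (Ext (moduleShortComplex f g hfg).X₃ (ModuleCat.of R W) 1) :=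
        H 1 le_rfl (by omega)
      obtain ⟨h', hh'⟩ := hS.exists_extension_of_subsingleton_ext (ModuleCat.ofHom h)
      exact ⟨h'.hom, congrArg ModuleCat.Hom.hom hh'⟩
    · have := hP' i hi
      have : Subsingleton (Ext (moduleShortComplex f g hfg).X₃ (ModuleCat.of R W) (1 + i)) :=
        H (1 + i) (by omega) (by omega)
      exact hS.subsingleton_ext_X₁_left rfl
  · rintro ⟨h1, h2⟩ i hi hin
    have := hP' i hi
    rcases hi.eq_or_lt with rfl | hi'
    · refine hS.subsingleton_ext_one_left fun h => ?_
      obtain ⟨h', hh'⟩ := h1 h.hom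
      exact ⟨ModuleCat.ofHom h', ModuleCat.hom_ext hh'⟩
    · obtain ⟨j, rfl⟩ : ∃ j, i = 1 + j := ⟨i - 1, by omega⟩
      have : Subsingleton (Ext (moduleShortComplex f g hfg).X₁ (ModuleCat.of R W) j) :=
        h2 j (by omega) (by omega)
      exact hS.subsingleton_ext_X₃_left rfl

theorem ExtVanishes.exists_extension {Q : Type u} [AddCommGroup Q] [Module R Q]
    (H : ExtVanishes R X W) (f : K →ₗ[R] Q) (g : Q →ₗ[R] X)
    (hf : Function.Injective f) (hfg : Function.Exact f g) (hg : Function.Surjective g)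
    (h : K →ₗ[R] W) : ∃ h' : Q →ₗ[R] W, h' ∘ₗ f = h := by
  have hS := moduleShortComplex_shortExact f g hf hfg hg
  have : Subsingleton (Ext (moduleShortComplex f g hfg).X₃ (ModuleCat.of R W) 1) := H 1 le_rfl
  obtain ⟨h', hh'⟩ := hS.exists_extension_of_subsingleton_ext (ModuleCat.ofHom h)
  exact ⟨h'.hom, congrArg ModuleCat.Hom.hom hh'⟩

theorem ExtVanishes.syzygy [Module.Projective R P]
    (H : ExtVanishes R X W) (f : K →ₗ[R] P) (g : P →ₗ[R] X)
    (hf : Function.Injective f) (hfg : Function.Exact f g) (hg : Function.Surjective g) :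
    ExtVanishes R K W :=
  extVanishes_iff_forall_upTo.2 fun n =>
    ((extVanishesUpTo_succ_iff f g hf hfg hg n).1 (extVanishes_iff_forall_upTo.1 H (n + 1))).2

section SecondVariable

variable (f : W₁ →ₗ[R] W₂) (g : W₂ →ₗ[R] W₃)
    (hf : Function.Injective f) (hfg : Function.Exact f g) (hg : Function.Surjective g)
include hf hfg hg

theorem ExtVanishes.exists_lift (H : ExtVanishes R X W₁)
    (h : X →ₗ[R] W₃) : ∃ h' : X →ₗ[R] W₂, g ∘ₗ h' = h := by
  have hS := moduleShortComplex_shortExact f g hf hfg hg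
  have : Subsingleton (Ext (ModuleCat.of R X) (moduleShortComplex f g hfg).X₁ 1) := H 1 le_rfl
  obtain ⟨h', hh'⟩ := hS.exists_lift_of_subsingleton_ext (ModuleCat.ofHom h)
  exact ⟨h'.hom, congrArg ModuleCat.Hom.hom hh'⟩

theorem ExtVanishes.of_extension (H₁ : ExtVanishes R X W₁) (H₃ : ExtVanishes R X W₃) :
    ExtVanishes R X W₂ := fun i hi => by
  have hS := moduleShortComplex_shortExact f g hf hfg hg
  have : Subsingleton (Ext (ModuleCat.of R X) (moduleShortComplex f g hfg).X₁ i) := H₁ i hi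
  have : Subsingleton (Ext (ModuleCat.of R X) (moduleShortComplex f g hfg).X₃ i) := H₃ i hi
  exact hS.subsingleton_ext_X₂_right

theorem ExtVanishes.of_quotient (H₁ : ExtVanishes R X W₁) (H₂ : ExtVanishes R X W₂) :
    ExtVanishes R X W₃ := fun i hi => by
  have hS := moduleShortComplex_shortExact f g hf hfg hg
  have : Subsingleton (Ext (ModuleCat.of R X) (moduleShortComplex f g hfg).X₁ (i + 1)) :=
    H₁ (i + 1) (by omega)
  have : Subsingleton (Ext (ModuleCat.of R X) (moduleShortComplex f g hfg).X₂ i) := H₂ i hi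
  exact hS.subsingleton_ext_X₃_right

theorem ExtVanishes.of_submodule (H₂ : ExtVanishes R X W₂) (H₃ : ExtVanishes R X W₃)
    (hlift : ∀ h : X →ₗ[R] W₃, ∃ h' : X →ₗ[R] W₂, g ∘ₗ h' = h) :
    ExtVanishes R X W₁ := fun i hi => by
  have hS := moduleShortComplex_shortExact f g hf hfg hg
  have : Subsingleton (Ext (ModuleCat.of R X) (moduleShortComplex f g hfg).X₂ i) := H₂ i hi
  rcases hi.eq_or_lt with rfl | hi'
  · refine hS.subsingleton_ext_one_right fun h => ?_
    obtain ⟨h', hh'⟩ := hlift h.hom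
    exact ⟨ModuleCat.ofHom h', ModuleCat.hom_ext hh'⟩
  · obtain ⟨j, rfl⟩ : ∃ j, i = j + 1 := ⟨i - 1, by omega⟩
    have : Subsingleton (Ext (ModuleCat.of R X) (moduleShortComplex f g hfg).X₃ j) :=
      H₃ j (by omega)
    exact hS.subsingleton_ext_X₁_right

end SecondVariable

theorem ExtVanishes.of_retract (H : ExtVanishes R X W₂) (s : W₁ →ₗ[R] W₂) (r : W₂ →ₗ[R] W₁)
    (hrs : ∀ w, r (s w) = w) : ExtVanishes R X W₁ := by
  refine fun i hi => subsingleton_ext_of_forall_eq_zero fun x => ?_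
  have h1 : ModuleCat.ofHom s ≫ ModuleCat.ofHom r = 𝟙 (ModuleCat.of R W₁) := by
    ext w; exact hrs w
  have h2 : (x.comp (Ext.mk₀ (ModuleCat.ofHom s)) (add_zero i)).comp
      (Ext.mk₀ (ModuleCat.ofHom r)) (add_zero i) = x := by
    rw [Ext.comp_assoc_of_third_deg_zero, Ext.mk₀_comp_mk₀, h1, Ext.comp_mk₀_id]
  have h3 := H i hi
  rw [← h2, h3.elim (x.comp _ _) 0, Ext.zero_comp]

theorem extVanishes_of_injective [Module.Injective R W] : ExtVanishes R X W := by
  have : Injective (ModuleCat.of R W) := Module.injective_object_of_injective_module R W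
  refine fun i hi => subsingleton_ext_of_forall_eq_zero fun x => ?_
  obtain ⟨j, rfl⟩ : ∃ j, i = j + 1 := ⟨i - 1, by omega⟩
  exact Ext.eq_zero_of_injective x

theorem extVanishes_pi (H : ExtVanishes R X W) (n : ℕ) : ExtVanishes R X (Fin n → W) := by
  induction n with
  | zero =>
    exact ExtVanishes.of_retract (W₂ := W) H 0 0 fun w => Subsingleton.elim _ _
  | succ n ih =>
    have e : ((Fin n → W) × W) ≃ₗ[R] (Fin (n + 1) → W) := 
      (LinearEquiv.prodComm R _ _).trans (Fin.consLinearEquiv R (fun _ => W))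
    have h1 : ExtVanishes R X ((Fin n → W) × W) :=
      ExtVanishes.of_extension (LinearMap.inl R _ _) (LinearMap.snd R _ _) LinearMap.inl_injective
        Function.Exact.inl_snd LinearMap.snd_surjective ih H
    exact h1.of_retract e.symm.toLinearMap e.toLinearMap e.apply_symm_apply

end ExtVanishing

/-! ### Comparison of `Ext` along a surjective ring homomorphism -/

section Comparison

variable {S R : Type u} [Ring S] [Ring R] {σ : S →+* R}

theorem ker_smul_top_le_ker {N C : Type u} [AddCommGroup N] [Module S N] [AddCommGroup C]
    [Module R C] (q : N →ₛₗ[σ] C) :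
    RingHom.ker σ • (⊤ : Submodule S N) ≤ LinearMap.ker q := by
  refine Submodule.smul_le.2 fun s hs n _ => ?_
  rw [LinearMap.mem_ker, map_smulₛₗ, (RingHom.mem_ker).1 hs, zero_smul]

theorem exists_factor_of_ker_le {N C W : Type u} [AddCommGroup N] [Module S N] [AddCommGroup C]
    [Module R C] [AddCommGroup W] [Module R W] [Module S W]
    (hσ : Function.Surjective σ) (hW : ∀ (s : S) (w : W), s • w = σ s • w) (q : N →ₛₗ[σ] C)
    (hq : Function.Surjective q) (hker : LinearMap.ker q ≤ RingHom.ker σ • (⊤ : Submodule S N))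
    (h : N →ₗ[S] W) : ∃ h' : C →ₗ[R] W, ∀ n, h' (q n) = h n := by
  have hz : ∀ n, q n = 0 → h n = 0 := fun n hn => by
    have h1 : RingHom.ker σ • (⊤ : Submodule S N) ≤ LinearMap.ker h := by
      refine Submodule.smul_le.2 fun s hs n _ => ?_
      rw [LinearMap.mem_ker, map_smul, hW, (RingHom.mem_ker).1 hs, zero_smul]
    exact h1 (hker hn)
  have he : ∀ n n', q n = q n' → h n = h n' := fun n n' hn => by
    rw [← sub_eq_zero, ← map_sub]
    exact hz _ (by rw [map_sub, hn, sub_self])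
  let g := Function.surjInv hq
  have hg : ∀ c, q (g c) = c := Function.surjInv_eq hq
  refine ⟨⟨⟨fun c => h (g c), fun c c' => ?_⟩, fun r c => ?_⟩, fun n => he _ _ (hg _)⟩
  · rw [← map_add]
    exact he _ _ (by rw [map_add, hg, hg, hg])
  · obtain ⟨s, rfl⟩ := hσ r
    rw [RingHom.id_apply, ← hW, ← map_smul]
    exact he _ _ (by rw [map_smulₛₗ, hg, hg])

/-- Reduction of the coefficients of a free module along a ring homomorphism. -/
noncomputable def finsuppReduction (σ : S →+* R) (I : Type u) : (I →₀ S) →ₛₗ[σ] (I →₀ R) where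
  toFun := Finsupp.mapRange σ (map_zero σ)
  map_add' := Finsupp.mapRange_add (map_add σ)
  map_smul' s x := by
    ext i
    simp

theorem finsuppReduction_single (I : Type u) (i : I) (s : S) :
    finsuppReduction σ I (Finsupp.single i s) = Finsupp.single i (σ s) :=
  Finsupp.mapRange_single (hf := map_zero σ)

theorem finsuppReduction_surjective (hσ : Function.Surjective σ) (I : Type u) :
    Function.Surjective (finsuppReduction σ I) :=
  Finsupp.mapRange_surjective _ (map_zero σ) hσ

theorem ker_finsuppReduction (I : Type u) :
    LinearMap.ker (finsuppReduction σ I) ≤ RingHom.ker σ • (⊤ : Submodule S (I →₀ S)) := by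
  intro x hx
  rw [← Finsupp.sum_single x]
  refine Submodule.sum_mem _ fun i _ => ?_
  rw [show Finsupp.single i (x i) = x i • Finsupp.single i (1 : S) by simp]
  refine Submodule.smul_mem_smul ?_ trivial
  exact DFunLike.congr_fun (LinearMap.mem_ker.1 hx) i

section Step

variable {N C P P' : Type u} [AddCommGroup N] [Module S N] [AddCommGroup C] [Module R C]
  [AddCommGroup P] [Module S P] [AddCommGroup P'] [Module R P']
  {q : N →ₛₗ[σ] C} {p : P →ₛₗ[σ] P'} {g : P →ₗ[S] N} {g' : P' →ₗ[R] C}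

theorem exists_semilinearMap_ker (hpg : ∀ x, g' (p x) = q (g x))
    (hker : LinearMap.ker q ≤ RingHom.ker σ • (⊤ : Submodule S N))
    (hg : Function.Surjective g) (hp : Function.Surjective p)
    (hpker : LinearMap.ker p ≤ RingHom.ker σ • (⊤ : Submodule S P))
    (hJ : LinearMap.ker g ⊓ RingHom.ker σ • (⊤ : Submodule S P) ≤
          RingHom.ker σ • LinearMap.ker g) :
    ∃ qK : LinearMap.ker g →ₛₗ[σ] LinearMap.ker g', Function.Surjective qK ∧
      LinearMap.ker qK ≤ RingHom.ker σ • (⊤ : Submodule S (LinearMap.ker g)) ∧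
      ∀ x, (qK x : P') = p x := by
  let qK : LinearMap.ker g →ₛₗ[σ] LinearMap.ker g' :=
    (p.comp (LinearMap.ker g).subtype).codRestrict (LinearMap.ker g') fun x => by
      rw [LinearMap.mem_ker, LinearMap.comp_apply, hpg, Submodule.subtype_apply,
        LinearMap.mem_ker.1 x.2, map_zero]
  refine ⟨qK, ?_, fun x hx => ?_, fun x => rfl⟩
  · rintro ⟨c, hc⟩
    obtain ⟨x, rfl⟩ := hp c
    have h1 : g x ∈ RingHom.ker σ • (⊤ : Submodule S N) :=
      hker (by rw [LinearMap.mem_ker, ← hpg]; exact hc)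
    rw [← LinearMap.range_eq_top.2 hg, LinearMap.range_eq_map, ← Submodule.map_smul''] at h1
    obtain ⟨y, hy, hyx⟩ := h1
    have hpy : p y = 0 := ker_smul_top_le_ker p hy
    refine ⟨⟨x - y, by rw [LinearMap.mem_ker, map_sub, hyx, sub_self]⟩, Subtype.ext ?_⟩
    change p (x - y) = p x
    rw [map_sub, hpy, sub_zero]
  · have h1 : (x : P) ∈ RingHom.ker σ • LinearMap.ker g :=
      hJ ⟨x.2, hpker (congrArg Subtype.val (LinearMap.mem_ker.1 hx))⟩
    have h2 : RingHom.ker σ • LinearMap.ker g =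
        (RingHom.ker σ • (⊤ : Submodule S (LinearMap.ker g))).map
          (LinearMap.ker g).subtype := by
      rw [Submodule.map_smul'', Submodule.map_subtype_top]
    rw [h2] at h1
    obtain ⟨y, hy, hyx⟩ := h1
    rwa [← Subtype.ext hyx]

theorem extension_property_baseChange_iff {K K' : Type u} [AddCommGroup K] [Module S K]
    [AddCommGroup K'] [Module R K'] {qK : K →ₛₗ[σ] K'} {f : K →ₗ[S] P} {f' : K' →ₗ[R] P'}
    (hpf : ∀ x, f' (qK x) = p (f x)) (hσ : Function.Surjective σ)
    (hp : Function.Surjective p)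
    (hpker : LinearMap.ker p ≤ RingHom.ker σ • (⊤ : Submodule S P))
    (hqK : Function.Surjective qK)
    (hkerK : LinearMap.ker qK ≤ RingHom.ker σ • (⊤ : Submodule S K))
    {W : Type u} [AddCommGroup W] [Module R W] [Module S W]
    (hW : ∀ (s : S) (w : W), s • w = σ s • w) :
    (∀ h : K →ₗ[S] W, ∃ h' : P →ₗ[S] W, h' ∘ₗ f = h) ↔
      ∀ h : K' →ₗ[R] W, ∃ h' : P' →ₗ[R] W, h' ∘ₗ f' = h := by
  refine ⟨fun H h => ?_, fun H h => ?_⟩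
  · let hS : K →ₗ[S] W :=
      { toFun := fun x => h (qK x)
        map_add' := fun x y => by rw [map_add, map_add]
        map_smul' := fun s x => by rw [map_smulₛₗ, map_smul, RingHom.id_apply, hW] }
    obtain ⟨h', hh'⟩ := H hS
    obtain ⟨h'', hh''⟩ := exists_factor_of_ker_le hσ hW p hp hpker h'
    refine ⟨h'', LinearMap.ext fun c => ?_⟩
    obtain ⟨x, rfl⟩ := hqK c
    rw [LinearMap.comp_apply, hpf, hh'']
    exact LinearMap.congr_fun hh' x
  · obtain ⟨h', hh'⟩ := exists_factor_of_ker_le hσ hW qK hqK hkerK h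
    obtain ⟨h'', hh''⟩ := H h'
    let hS : P →ₗ[S] W :=
      { toFun := fun x => h'' (p x)
        map_add' := fun x y => by rw [map_add, map_add]
        map_smul' := fun s x => by rw [map_smulₛₗ, map_smul, RingHom.id_apply, hW] }
    refine ⟨hS, LinearMap.ext fun x => ?_⟩
    change h'' (p (f x)) = h x
    rw [← hpf, ← hh', ← hh'']
    rfl

theorem extVanishesUpTo_succ_baseChange_iff [Module.Projective S P] [Module.Projective R P']
    {K K' : Type u} [AddCommGroup K] [Module S K]
    [AddCommGroup K'] [Module R K'] {qK : K →ₛₗ[σ] K'} {f : K →ₗ[S] P} {f' : K' →ₗ[R] P'}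
    (hpf : ∀ x, f' (qK x) = p (f x)) (hσ : Function.Surjective σ)
    (hp : Function.Surjective p)
    (hpker : LinearMap.ker p ≤ RingHom.ker σ • (⊤ : Submodule S P))
    (hqK : Function.Surjective qK)
    (hkerK : LinearMap.ker qK ≤ RingHom.ker σ • (⊤ : Submodule S K))
    (hf : Function.Injective f) (hfg : Function.Exact f g) (hg : Function.Surjective g)
    (hf' : Function.Injective f') (hfg' : Function.Exact f' g') (hg' : Function.Surjective g')
    {W : Type u} [AddCommGroup W] [Module R W] [Module S W]
    (hW : ∀ (s : S) (w : W), s • w = σ s • w) {n : ℕ}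
    (hn : ExtVanishesUpTo S n K W ↔ ExtVanishesUpTo R n K' W) :
    ExtVanishesUpTo S (n + 1) N W ↔ ExtVanishesUpTo R (n + 1) C W := by
  rw [extVanishesUpTo_succ_iff f g hf hfg hg, extVanishesUpTo_succ_iff f' g' hf' hfg' hg', hn,
    extension_property_baseChange_iff hpf hσ hp hpker hqK hkerK hW]

end Step

theorem exists_free_covers (hσ : Function.Surjective σ) {N C : Type u} [AddCommGroup N]
    [Module S N] [AddCommGroup C] [Module R C] (q : N →ₛₗ[σ] C) (hq : Function.Surjective q) :
    ∃ (P P' : Type u) (_ : AddCommGroup P) (_ : Module S P) (_ : AddCommGroup P')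
      (_ : Module R P') (_ : Module.Projective S P) (_ : Module.Projective R P')
      (p : P →ₛₗ[σ] P') (g : P →ₗ[S] N) (g' : P' →ₗ[R] C),
      Function.Surjective p ∧ LinearMap.ker p ≤ RingHom.ker σ • (⊤ : Submodule S P) ∧
      Function.Surjective g ∧ Function.Surjective g' ∧ ∀ x, g' (p x) = q (g x) := by
  have hg : Function.Surjective (Finsupp.linearCombination S (id : N → N)) :=
    Finsupp.linearCombination_id_surjective S N
  have hpg : ∀ x, Finsupp.linearCombination R q (finsuppReduction σ N x) =
      q (Finsupp.linearCombination S (id : N → N) x) := fun x => by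
    induction x using Finsupp.induction_linear with
    | zero => simp
    | add x y hx hy => rw [map_add, map_add, map_add, map_add, hx, hy]
    | single i s =>
      simp only [finsuppReduction_single, Finsupp.linearCombination_single, id, map_smulₛₗ]
  refine ⟨N →₀ S, N →₀ R, _, _, _, _, inferInstance, inferInstance, finsuppReduction σ N,
    Finsupp.linearCombination S (id : N → N), Finsupp.linearCombination R q,
    finsuppReduction_surjective hσ N, ker_finsuppReduction N, hg, fun c => ?_, hpg⟩
  obtain ⟨m, rfl⟩ := hq c
  obtain ⟨x, rfl⟩ := hg m
  exact ⟨_, hpg x⟩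

/-- Change of rings for `Ext` along a surjection `σ : S → R`: if `𝒞` is a class of `S`-modules,
closed under syzygies, on which the base change `N ↦ N / (ker σ) N` is exact, then
`Ext_S(N, W)` and `Ext_R(N / (ker σ) N, W)` vanish simultaneously for `N ∈ 𝒞`. -/
theorem extVanishesUpTo_baseChange_iff (hσ : Function.Surjective σ)
    (𝒞 : ∀ (N : Type u) [AddCommGroup N] [Module S N], Prop)
    (h𝒞 : ∀ (N P : Type u) [AddCommGroup N] [Module S N] [AddCommGroup P] [Module S P]
      [Module.Projective S P] (g : P →ₗ[S] N), Function.Surjective g → 𝒞 N →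
        𝒞 (LinearMap.ker g) ∧
        LinearMap.ker g ⊓ RingHom.ker σ • (⊤ : Submodule S P) ≤
          RingHom.ker σ • LinearMap.ker g)
    {W : Type u} [AddCommGroup W] [Module R W] [Module S W]
    (hW : ∀ (s : S) (w : W), s • w = σ s • w) (n : ℕ) :
    ∀ {N C : Type u} [AddCommGroup N] [Module S N] [AddCommGroup C] [Module R C]
      (q : N →ₛₗ[σ] C), Function.Surjective q →
      LinearMap.ker q ≤ RingHom.ker σ • (⊤ : Submodule S N) → 𝒞 N →
      (ExtVanishesUpTo S n N W ↔ ExtVanishesUpTo R n C W) := by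
  induction n with
  | zero =>
    intros
    exact ⟨fun _ i hi hi' => by omega, fun _ i hi hi' => by omega⟩
  | succ n ih =>
    intro N C _ _ _ _ q hq hker hN
    obtain ⟨P, P', _, _, _, _, _, _, p, g, g', hp, hpker, hg, hg', hpg⟩ :=
      exists_free_covers hσ q hq
    obtain ⟨hK, hJ⟩ := h𝒞 N P g hg hN
    obtain ⟨qK, hqK, hkerK, hqp⟩ := exists_semilinearMap_ker hpg hker hg hp hpker hJ
    exact extVanishesUpTo_succ_baseChange_iff (K := LinearMap.ker g) (K' := LinearMap.ker g')
      (f := (LinearMap.ker g).subtype) (f' := (LinearMap.ker g').subtype) (g := g) (g' := g')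
      (p := p) (qK := qK) hqp hσ hp hpker hqK hkerK
      Subtype.val_injective (LinearMap.exact_subtype_ker_map g) hg
      Subtype.val_injective (LinearMap.exact_subtype_ker_map g') hg' hW (ih qK hqK hkerK hK)

end Comparison

/-! ### Coefficients of finite projective dimension -/

section ProjectiveDimension

open CategoryTheory

variable {S R : Type u} [Ring S] [Ring R]

theorem extVanishes_of_projective_of_restrictScalars {σ : S →+* R}
    {N : Type u} [AddCommGroup N] [Module S N] [Module S R]
    (hR : ∀ (s : S) (r : R), s • r = σ s • r) (H : ExtVanishes S N R)
    {W : Type u} [AddCommGroup W] [Module R W] [Module.Finite R W] [Module.Projective R W]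
    [Module S W] (hW : ∀ (s : S) (w : W), s • w = σ s • w) : ExtVanishes S N W := by
  obtain ⟨n, f, g, hf, -, hfg⟩ := Module.Finite.exists_comp_eq_id_of_projective R W
  let f' : (Fin n → R) →ₗ[S] W :=
    { f.toAddHom with
      map_smul' := fun s x => by
        rw [show s • x = σ s • x from funext fun i => hR s (x i), RingHom.id_apply, hW]
        exact f.map_smul _ _ }
  let g' : W →ₗ[S] (Fin n → R) :=
    { g.toAddHom with
      map_smul' := fun s x => by
        rw [RingHom.id_apply, hW,
          show s • g.toFun x = σ s • g.toFun x from funext fun i => hR s (g x i)]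
        exact g.map_smul _ _ }
  exact (extVanishes_pi H n).of_retract g' f' fun w => LinearMap.congr_fun hfg w

theorem extVanishes_of_hasProjectiveDimensionLT [IsNoetherianRing R] {σ : S →+* R}
    {N : Type u} [AddCommGroup N] [Module S N] [Module S R]
    (hR : ∀ (s : S) (r : R), s • r = σ s • r) (H : ExtVanishes S N R) (n : ℕ) :
    ∀ (W : Type u) [AddCommGroup W] [Module R W] [Module.Finite R W]
    [Module S W] (_ : ∀ (s : S) (w : W), s • w = σ s • w)
    (_ : HasProjectiveDimensionLT (ModuleCat.of R W) (n + 1)), ExtVanishes S N W := by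
  induction n with
  | zero =>
    intro W _ _ _ _ hW hd
    have : Module.Projective R W :=
      (IsProjective.iff_projective W).2 (projective_iff_hasProjectiveDimensionLT_one.2 hd)
    exact extVanishes_of_projective_of_restrictScalars hR H hW
  | succ n ih =>
    intro W _ _ _ _ hW hd
    obtain ⟨m, g, hg⟩ := Module.Finite.exists_fin' R W
    have hS := moduleShortComplex_shortExact (LinearMap.ker g).subtype g Subtype.val_injective
        (LinearMap.exact_subtype_ker_map g) hg
    have hP : HasProjectiveDimensionLT (ModuleCat.of R (Fin m → R)) 1 :=
      projective_iff_hasProjectiveDimensionLT_one.1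
        ((IsProjective.iff_projective _).1 inferInstance)
    have hK : HasProjectiveDimensionLT (ModuleCat.of R (LinearMap.ker g)) (n + 1) :=
      hS.hasProjectiveDimensionLT_X₁ (n + 1)
        (hasProjectiveDimensionLT_of_ge (ModuleCat.of R (Fin m → R)) 1 (n + 1) (by omega)) hd
    let _ : Module S (LinearMap.ker g) := Module.compHom _ σ
    have h1 : ExtVanishes S N (LinearMap.ker g) := ih _ (fun _ _ => rfl) hK
    have hRm : ∀ (s : S) (x : Fin m → R), s • x = σ s • x := fun s x => funext fun i => hR s (x i)
    have h2 : ExtVanishes S N (Fin m → R) := extVanishes_pi H m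
    let f' : LinearMap.ker g →ₗ[S] (Fin m → R) :=
      { (LinearMap.ker g).subtype with map_smul' := fun s x => (hRm s x).symm }
    let g' : (Fin m → R) →ₗ[S] W :=
      { g.toAddHom with
        map_smul' := fun s x => by
          rw [hRm, RingHom.id_apply, hW]
          exact g.map_smul _ _ }
    exact ExtVanishes.of_quotient f' g' Subtype.val_injective
      (LinearMap.exact_subtype_ker_map g) hg h1 h2

theorem extVanishes_of_projectiveDimension_lt_top [IsNoetherianRing R] {σ : S →+* R}
    {N : Type u} [AddCommGroup N] [Module S N] [Module S R]
    (hR : ∀ (s : S) (r : R), s • r = σ s • r) (H : ExtVanishes S N R)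
    {W : Type u} [AddCommGroup W] [Module R W] [Module.Finite R W]
    [Module S W] (hW : ∀ (s : S) (w : W), s • w = σ s • w)
    (hd : projectiveDimension (ModuleCat.of R W) < ⊤) : ExtVanishes S N W := by
  obtain ⟨n, hn⟩ : ∃ n : ℕ, projectiveDimension (ModuleCat.of R W) < n := by
    rcases h : projectiveDimension (ModuleCat.of R W) with _ | _ | n
    · exact ⟨0, WithBot.bot_lt_coe _⟩
    · rw [h] at hd
      exact absurd hd (lt_irrefl _)
    · exact ⟨n + 1, WithBot.coe_lt_coe.2 (WithTop.coe_lt_coe.2 (Nat.lt_succ_self n))⟩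
  have h := projectiveDimension_lt_iff.1 hn
  exact extVanishes_of_hasProjectiveDimensionLT hR H n W hW
    (hasProjectiveDimensionLT_of_ge _ n (n + 1) (by omega))

end ProjectiveDimension

/-! ### The duality with respect to an injective cogenerator -/

theorem IsInjectiveEnvelope.exists_linearMap_apply_ne_zero {k E : Type u} [CommRing k]
    [IsArtinianRing k] [AddCommGroup E] [Module k E] {ι : (k ⧸ Ring.jacobson k) →ₗ[k] E}
    (hE : IsInjectiveEnvelope ι) {N : Type u} [AddCommGroup N] [Module k N] {t : N}
    (ht : t ≠ 0) : ∃ l : N →ₗ[k] E, l t ≠ 0 := by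
  let I : Ideal k := LinearMap.ker (LinearMap.toSpanSingleton k N t)
  have hI : I ≠ ⊤ := fun h => ht (by
    have h1 : (1 : k) ∈ I := h ▸ Submodule.mem_top
    simpa [I] using h1)
  obtain ⟨m, hm, hIm⟩ := Ideal.exists_le_maximal I hI
  have hJ : Ring.jacobson k ≤ m := by
    rw [← Ideal.jacobson_bot]
    exact sInf_le ⟨bot_le, hm⟩
  have hss : IsSemisimpleModule k (k ⧸ Ring.jacobson k) :=
    (IsArtinian.isSemisimpleModule_iff_jacobson k _).2 (Module.jacobson_quotient_jacobson k k)
  let p : (k ⧸ Ring.jacobson k) →ₗ[k] (k ⧸ m) := Submodule.factor hJ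
  obtain ⟨s, hs⟩ := IsSemisimpleModule.lifting_property p (Submodule.factor_surjective hJ) LinearMap.id
  let i : (k ⧸ I) →ₗ[k] N := I.liftQ (LinearMap.toSpanSingleton k N t) le_rfl
  have hi : Function.Injective i := LinearMap.ker_eq_bot.1 (Submodule.ker_liftQ_eq_bot' _ _ rfl)
  obtain ⟨l, hl⟩ := hE.injective_module.out i hi (ι ∘ₗ s ∘ₗ Submodule.factor hIm)
  refine ⟨l, fun h0 => ?_⟩
  have h1 : i (Submodule.Quotient.mk 1) = t := one_smul k t
  have h2 := hl (Submodule.Quotient.mk 1)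
  rw [h1, h0] at h2
  have h3 : s (Submodule.Quotient.mk 1) = 0 := hE.injective (by rw [map_zero]; exact h2.symm)
  have h4 : (Submodule.Quotient.mk 1 : k ⧸ m) = 0 := by
    have h5 := LinearMap.congr_fun hs (Submodule.Quotient.mk 1)
    rw [LinearMap.comp_apply, h3, map_zero] at h5
    exact h5.symm
  exact hm.ne_top ((Ideal.eq_top_iff_one m).2 ((Submodule.Quotient.mk_eq_zero m).1 h4))

namespace ArtinDual

variable (k M E : Type u) [CommRing k] [AddCommGroup M] [Module k M]
  [AddCommGroup E] [Module k E]

/-- The underlying linear maps of the elements of `D(M)`. -/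
def toLinearMap : ArtinDual k M E ≃+ (M →ₗ[k] E) := AddEquiv.refl _

variable {k M E}

theorem toLinearMap_smul {A : Type u} [Ring A] [Algebra k A] [Module Aᵐᵒᵖ M]
    [IsScalarTower k Aᵐᵒᵖ M] (a : A) (f : ArtinDual k M E) (m : M) :
    toLinearMap k M E (a • f) m = toLinearMap k M E f (MulOpposite.op a • m) := rfl

theorem ext_toLinearMap {f g : ArtinDual k M E}
    (h : ∀ m, toLinearMap k M E f m = toLinearMap k M E g m) : f = g :=
  LinearMap.ext h

end ArtinDual

section

variable {k E : Type u} [CommRing k] [AddCommGroup E] [Module k E]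

open ArtinDual

theorem artinDual_self_injective [Module.Injective k E] (R : Type u) [Ring R] [Algebra k R] :
    Module.Injective R (ArtinDual k R E) := by
  refine Module.Baer.injective fun I g => ?_
  let l : I →ₗ[k] E :=
    { toFun := fun x => toLinearMap k R E (g x) 1
      map_add' := fun x y => by rw [map_add, map_add, LinearMap.add_apply]
      map_smul' := fun c x => by
        rw [← algebraMap_smul R c x, map_smul, toLinearMap_smul, RingHom.id_apply, ← map_smul]
        congr 1
        rw [op_smul_eq_mul, one_mul, Algebra.algebraMap_eq_smul_one] }
  obtain ⟨l', hl'⟩ := Module.Injective.out (I.subtype.restrictScalars k)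
    Subtype.val_injective l
  let g' : R →ₗ[R] ArtinDual k R E :=
    { toFun := fun s => (toLinearMap k R E).symm (l' ∘ₗ LinearMap.mulRight k s)
      map_add' := fun s s' => ext_toLinearMap fun r => by
        rw [map_add]
        simp [mul_add]
      map_smul' := fun a s => ext_toLinearMap fun r => by
        rw [RingHom.id_apply, toLinearMap_smul]
        simp [mul_assoc] }
  refine ⟨g', fun x hx => ext_toLinearMap fun r => ?_⟩
  have h1 : toLinearMap k R E (g' x) r = l' (r * x) := rfl
  have h2 : l' (r * x) = l (r • ⟨x, hx⟩) := hl' (r • ⟨x, hx⟩)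
  have h3 : l (r • ⟨x, hx⟩) = toLinearMap k R E (g (r • ⟨x, hx⟩)) 1 := rfl
  rw [h1, h2, h3, map_smul, toLinearMap_smul, op_smul_eq_mul, one_mul]

/-- If `Ext^1_S(N, D(R)) = 0`, then `R ⊗_S -` preserves exactness of `0 → K → P → N → 0`. -/
theorem ker_inf_ker_smul_top_le [IsArtinianRing k] {ι : (k ⧸ Ring.jacobson k) →ₗ[k] E}
    (hE : IsInjectiveEnvelope ι) {S R : Type u} [Ring S] [Ring R] [Algebra k S] [Algebra k R]
    {σ : S →+* R} (hσ : Function.Surjective σ)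
    (hσk : ∀ c : k, σ (algebraMap k S c) = algebraMap k R c) [Module S (ArtinDual k R E)]
    (hD : ∀ (s : S) (f : ArtinDual k R E), s • f = σ s • f)
    {N P : Type u} [AddCommGroup N] [Module S N] [AddCommGroup P] [Module S P]
    (g : P →ₗ[S] N) (hg : Function.Surjective g) (hN : ExtVanishes S N (ArtinDual k R E)) :
    LinearMap.ker g ⊓ RingHom.ker σ • (⊤ : Submodule S P) ≤ RingHom.ker σ • LinearMap.ker g := by
  rintro x ⟨hxg, hxJ⟩
  by_contra hx
  let J : Submodule S (LinearMap.ker g) := RingHom.ker σ • ⊤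
  let x' : LinearMap.ker g := ⟨x, hxg⟩
  have hx' : J.mkQ x' ≠ 0 := fun h => hx (by
    have h1 : x' ∈ J := (Submodule.Quotient.mk_eq_zero J).1 h
    have h2 : RingHom.ker σ • LinearMap.ker g = J.map (LinearMap.ker g).subtype := by
      rw [Submodule.map_smul'', Submodule.map_subtype_top]
    rw [h2]
    exact ⟨x', h1, rfl⟩)
  let _ : Module k (LinearMap.ker g ⧸ J) := Module.compHom _ (algebraMap k S)
  obtain ⟨l, hl⟩ := hE.exists_linearMap_apply_ne_zero hx'
  have hJ : ∀ (s s' : S) (n : LinearMap.ker g), σ s = σ s' → J.mkQ (s • n) = J.mkQ (s' • n) :=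
    fun s s' n h => by
      rw [← sub_eq_zero, ← map_sub, ← sub_smul]
      refine (Submodule.Quotient.mk_eq_zero J).2 (Submodule.smul_mem_smul ?_ trivial)
      rw [RingHom.mem_ker, map_sub, h, sub_self]
  let τ : R → S := Function.surjInv hσ
  have hτ : ∀ r, σ (τ r) = r := Function.surjInv_eq hσ
  let h : LinearMap.ker g →ₗ[S] ArtinDual k R E :=
    { toFun := fun n => (toLinearMap k R E).symm
        { toFun := fun r => l (J.mkQ (τ r • n))
          map_add' := fun r r' => by
            rw [← map_add, ← map_add, ← add_smul]
            exact congrArg l (hJ _ _ _ (by rw [map_add, hτ, hτ, hτ]))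
          map_smul' := fun c r => by
            rw [RingHom.id_apply, ← map_smul]
            refine congrArg l ?_
            change _ = algebraMap k S c • J.mkQ (τ r • n)
            rw [← map_smul, smul_smul]
            refine hJ _ _ _ ?_
            rw [map_mul, hτ, hτ, hσk, Algebra.smul_def] }
      map_add' := fun n n' => ext_toLinearMap fun r => by
        rw [map_add]
        change l (J.mkQ (τ r • (n + n'))) = l (J.mkQ (τ r • n)) + l (J.mkQ (τ r • n'))
        rw [smul_add, map_add, map_add]
      map_smul' := fun s n => ext_toLinearMap fun r => by
        rw [RingHom.id_apply, hD, toLinearMap_smul]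
        change l (J.mkQ (τ r • s • n)) = l (J.mkQ (τ (r * σ s) • n))
        rw [smul_smul]
        exact congrArg l (hJ _ _ _ (by rw [map_mul, hτ, hτ])) }
  obtain ⟨h', hh'⟩ := hN.exists_extension (K := LinearMap.ker g) (LinearMap.ker g).subtype g
    Subtype.val_injective (LinearMap.exact_subtype_ker_map g) hg h
  have h1 : RingHom.ker σ • (⊤ : Submodule S P) ≤ LinearMap.ker h' := by
    refine Submodule.smul_le.2 fun s hs n _ => ?_
    rw [LinearMap.mem_ker, map_smul, hD, (RingHom.mem_ker).1 hs, zero_smul]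
  have h2 : h x' = 0 := (LinearMap.congr_fun hh' x').symm.trans (h1 hxJ)
  have h3 : l (J.mkQ (τ 1 • x')) = 0 := by
    change toLinearMap k R E (h x') 1 = 0
    rw [h2, map_zero, LinearMap.zero_apply]
  rw [hJ (τ 1) 1 x' (by rw [hτ, map_one]), one_smul] at h3
  exact hl h3

end

/-! ### Functionals on `M ⊗_A Y` -/

section BimodTensorFunctionals

theorem bimodTensor_induction {B M A Y : Type u} [Ring B] [Ring A] [AddCommGroup M] [Module B M]
    [Module Aᵐᵒᵖ M] [AddCommGroup Y] [Module A Y] {p : BimodTensor B M A Y → Prop}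
    (tmul : ∀ m y, p (bimodTmul B A m y)) (add : ∀ s t, p s → p t → p (s + t))
    (t : BimodTensor B M A Y) : p t := by
  obtain ⟨t, rfl⟩ := (bimodTensorRelations B M A Y).mkQ_surjective t
  induction t using TensorProduct.induction_on with
  | zero =>
    have h := tmul (0 : M) (0 : Y)
    rwa [bimodTmul, TensorProduct.zero_tmul] at h
  | tmul m y => exact tmul m y
  | add s t hs ht =>
    rw [map_add]
    exact add _ _ hs ht

open ArtinDual

variable {k A B M E Y : Type u} [CommRing k] [Ring A] [Algebra k A] [Ring B] [Algebra k B]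
    [AddCommGroup M] [Module k M] [Module B M] [Module Aᵐᵒᵖ M]
    [IsScalarTower k B M] [IsScalarTower k Aᵐᵒᵖ M]
    [AddCommGroup E] [Module k E] [AddCommGroup Y] [Module A Y]

theorem exists_functional_bimodTensor [SMulCommClass B Aᵐᵒᵖ M] (γ : Y →ₗ[A] ArtinDual k M E) :
    ∃ l : BimodTensor B M A Y →ₗ[k] E,
      ∀ m y, l (bimodTmul B A m y) = toLinearMap k M E (γ y) m := by
  let l₀ : M ⊗[ℤ] Y →ₗ[ℤ] E := TensorProduct.lift
    (LinearMap.mk₂ ℤ (fun m y => toLinearMap k M E (γ y) m)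
      (fun m m' y => map_add _ _ _) (fun c m y => map_zsmul _ _ _)
      (fun m y y' => by rw [map_add, map_add, LinearMap.add_apply])
      (fun m c y => by rw [map_zsmul, map_zsmul, LinearMap.smul_apply]))
  have hl₀ : ∀ m y, l₀ (m ⊗ₜ y) = toLinearMap k M E (γ y) m := fun m y => rfl
  let l₁ : M ⊗[ℤ] Y →ₗ[k] E :=
    { toFun := l₀
      map_add' := map_add l₀
      map_smul' := fun c t => by
        rw [RingHom.id_apply]
        induction t using TensorProduct.induction_on with
        | zero => rw [smul_zero, map_zero, smul_zero]
        | tmul m y => rw [TensorProduct.smul_tmul', hl₀, hl₀, map_smul]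
        | add s t hs ht => rw [smul_add, map_add, hs, ht, map_add, smul_add] }
  have hrel : (bimodTensorRelations B M A Y).restrictScalars k ≤ LinearMap.ker l₁ := by
    intro t ht
    refine Submodule.closure_induction (p := fun t _ => l₁ t = 0) (map_zero l₁)
      (fun s t _ _ hs ht => by rw [map_add, hs, ht, add_zero]) ?_ ht
    rintro b _ ⟨m, a, y, rfl⟩
    change l₀ (b • (_ - _)) = 0
    rw [smul_sub, TensorProduct.smul_tmul', TensorProduct.smul_tmul', map_sub, hl₀, hl₀, map_smul γ,
      toLinearMap_smul, smul_comm, sub_self]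
  exact ⟨((bimodTensorRelations B M A Y).restrictScalars k).liftQ l₁ hrel, fun m y => rfl⟩

/-- The `A`-linear map `Y → D(M)` that corresponds to a functional on `M ⊗_A Y`. -/
def bimodTensorCurry (l : BimodTensor B M A Y →ₗ[k] E) : Y →ₗ[A] ArtinDual k M E where
  toFun y := (toLinearMap k M E).symm
    { toFun := fun m => l (bimodTmul B A m y)
      map_add' := fun m m' => by rw [add_bimodTmul, map_add]
      map_smul' := fun c m => by
        rw [RingHom.id_apply, ← map_smul, ← algebraMap_smul B c m, smul_bimodTmul,
          algebraMap_smul] }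
  map_add' y y' := ext_toLinearMap fun m => by
    rw [map_add]
    change l _ = l _ + l _
    rw [bimodTmul_add, map_add]
  map_smul' a y := ext_toLinearMap fun m => by
    rw [RingHom.id_apply, toLinearMap_smul]
    change l _ = l _
    rw [op_smul_bimodTmul]

theorem bimodTensorCurry_apply (l : BimodTensor B M A Y →ₗ[k] E) (m : M) (y : Y) :
    toLinearMap k M E (bimodTensorCurry l y) m = l (bimodTmul B A m y) := rfl

end BimodTensorFunctionals

/-! ### The triangular matrix ring as an algebra -/

namespace TriangularMatrixRing

variable {k A B M : Type u} [Ring A] [Ring B] [AddCommGroup M] [Module B M] [Module Aᵐᵒᵖ M]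
    [SMulCommClass B Aᵐᵒᵖ M]

/-- The projection to the upper left corner. -/
def toB : TriangularMatrixRing B M A →+* B where
  toFun := b
  map_one' := rfl
  map_mul' _ _ := rfl
  map_zero' := rfl
  map_add' _ _ := rfl

/-- The projection to the lower right corner. -/
def toA : TriangularMatrixRing B M A →+* A where
  toFun := a
  map_one' := rfl
  map_mul' _ _ := rfl
  map_zero' := rfl
  map_add' _ _ := rfl

@[simp] theorem toB_apply (t : TriangularMatrixRing B M A) : toB t = t.b := rfl
@[simp] theorem toA_apply (t : TriangularMatrixRing B M A) : toA t = t.a := rfl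

theorem toB_surjective : Function.Surjective (toB : TriangularMatrixRing B M A →+* B) :=
  fun b => ⟨⟨b, 0, 0⟩, rfl⟩

theorem toA_surjective : Function.Surjective (toA : TriangularMatrixRing B M A →+* A) :=
  fun a => ⟨⟨0, 0, a⟩, rfl⟩

section

variable {A B M : Type u} [SMul k A] [SMul k B] [SMul k M]

instance : SMul k (TriangularMatrixRing B M A) := ⟨fun c t => ⟨c • t.b, c • t.m, c • t.a⟩⟩

@[simp] theorem smul_b (c : k) (t : TriangularMatrixRing B M A) : (c • t).b = c • t.b := rfl
@[simp] theorem smul_m (c : k) (t : TriangularMatrixRing B M A) : (c • t).m = c • t.m := rfl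
@[simp] theorem smul_a (c : k) (t : TriangularMatrixRing B M A) : (c • t).a = c • t.a := rfl

end

variable [CommRing k] [Algebra k A] [Algebra k B] [Module k M] [IsScalarTower k B M]
  [IsScalarTower k Aᵐᵒᵖ M]

instance : Algebra k (TriangularMatrixRing B M A) where
  algebraMap :=
    { toFun := fun c => ⟨algebraMap k B c, 0, algebraMap k A c⟩
      map_one' := by ext <;> simp
      map_mul' := fun c d => by ext <;> simp
      map_zero' := by ext <;> simp
      map_add' := fun c d => by ext <;> simp }
  commutes' c t := by
    ext
    · exact Algebra.commutes c t.b
    · have h : MulOpposite.op (algebraMap k A c) • t.m = c • t.m :=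
        algebraMap_smul Aᵐᵒᵖ c t.m
      simp [h]
    · exact Algebra.commutes c t.a
  smul_def' c t := by
    ext
    · exact Algebra.smul_def c t.b
    · simp
    · exact Algebra.smul_def c t.a

theorem toB_algebraMap (c : k) :
    toB (algebraMap k (TriangularMatrixRing B M A) c) = algebraMap k B c := rfl

end TriangularMatrixRing

section TriangularExt

open TriangularMatrixRing

variable {A B M : Type u} [Ring A] [Ring B] [AddCommGroup M] [Module B M]
  [Module Aᵐᵒᵖ M] [SMulCommClass B Aᵐᵒᵖ M]

section Coefficients

variable {N : Type u} [AddCommGroup N] [Module (TriangularMatrixRing B M A) N]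

section Lower

variable [Module (TriangularMatrixRing B M A) A] (hA : ∀ (s : TriangularMatrixRing B M A) (a : A), s • a = toA s • a)

/-- The projection of the triangular matrix ring to its lower right corner, as a map of left
modules. -/
def TriangularMatrixRing.lowerProjection :
    TriangularMatrixRing B M A →ₗ[TriangularMatrixRing B M A] A where
  toFun t := t.a
  map_add' _ _ := rfl
  map_smul' s t := by simp [hA]

theorem TriangularMatrixRing.lowerProjection_surjective :
    Function.Surjective (lowerProjection hA) := fun a => ⟨⟨0, 0, a⟩, rfl⟩

end Lower

variable [Module (TriangularMatrixRing B M A) B] (hB : ∀ (s : TriangularMatrixRing B M A) (b : B), s • b = toB s • b)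

include hB in
theorem extVanishes_upper_of_extVanishes_self
    (H : ExtVanishes (TriangularMatrixRing B M A) N (TriangularMatrixRing B M A)) :
    ExtVanishes (TriangularMatrixRing B M A) N B :=
  H.of_retract (W₁ := B)
    { toFun := fun b => (⟨b, 0, 0⟩ : TriangularMatrixRing B M A)
      map_add' := fun b b' => by ext <;> simp
      map_smul' := fun s b => by ext <;> simp [hB] }
    { toFun := fun t => t.b
      map_add' := fun _ _ => rfl
      map_smul' := fun s t => by simp [hB] }
    fun b => rfl

variable [Module (TriangularMatrixRing B M A) M] (hM : ∀ (s : TriangularMatrixRing B M A) (m : M), s • m = toB s • m)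

/-- The first row `(b, m)` as a left ideal of the triangular matrix ring. -/
def TriangularMatrixRing.upperInclusion :
    (B × M) →ₗ[TriangularMatrixRing B M A] TriangularMatrixRing B M A where
  toFun p := ⟨p.1, p.2, 0⟩
  map_add' p q := by ext <;> simp
  map_smul' s p := by ext <;> simp [hB, hM]

theorem TriangularMatrixRing.upperInclusion_injective :
    Function.Injective (upperInclusion hB hM) := fun _ _ h =>
  Prod.ext (congrArg TriangularMatrixRing.b h) (congrArg TriangularMatrixRing.m h)

theorem TriangularMatrixRing.exact_upperInclusion_lowerProjection
    [Module (TriangularMatrixRing B M A) A] (hA : ∀ (s : TriangularMatrixRing B M A) (a : A), s • a = toA s • a) :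
    Function.Exact (upperInclusion hB hM) (lowerProjection hA) := fun t =>
  ⟨fun h => ⟨(t.b, t.m), TriangularMatrixRing.ext rfl rfl h.symm⟩, by rintro ⟨p, rfl⟩; rfl⟩

include hB hM in
theorem extVanishes_upper_prod [IsNoetherianRing B] [Module.Finite B M]
    (hpd : CategoryTheory.projectiveDimension (ModuleCat.of B M) < ⊤)
    (H : ExtVanishes (TriangularMatrixRing B M A) N B) :
    ExtVanishes (TriangularMatrixRing B M A) N (B × M) :=
  ExtVanishes.of_extension (LinearMap.inl (TriangularMatrixRing B M A) B M)
    (LinearMap.snd (TriangularMatrixRing B M A) B M) LinearMap.inl_injective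
    Function.Exact.inl_snd LinearMap.snd_surjective H
    (extVanishes_of_projectiveDimension_lt_top hB H hM hpd)

end Coefficients

variable {X Y : Type u} [AddCommGroup X] [Module B X] [AddCommGroup Y] [Module A Y]
  {φ : BimodTensor B M A Y →ₗ[B] X}

/-- The projection of `(X, Y, φ)` to `Y`. -/
def TripleModule.toLower (φ : BimodTensor B M A Y →ₗ[B] X) :
    TripleModule φ →ₛₗ[(toA : TriangularMatrixRing B M A →+* A)] Y where
  toFun := y
  map_add' _ _ := rfl
  map_smul' _ _ := rfl

/-- The projection of `(X, Y, φ)` to the cokernel of `φ`. -/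
def TripleModule.toCoker (φ : BimodTensor B M A Y →ₗ[B] X) :
    TripleModule φ →ₛₗ[(toB : TriangularMatrixRing B M A →+* B)] (X ⧸ LinearMap.range φ) where
  toFun v := (LinearMap.range φ).mkQ v.x
  map_add' v w := by simp
  map_smul' t v := by
    rw [smul_x, map_add, toB_apply, map_smul, add_eq_left]
    exact (Submodule.Quotient.mk_eq_zero _).2 ⟨_, rfl⟩

theorem TripleModule.ker_toLower_le :
    LinearMap.ker (toLower φ) ≤ RingHom.ker (toA : TriangularMatrixRing B M A →+* A) • (⊤ :
      Submodule (TriangularMatrixRing B M A) (TripleModule φ)) := by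
  intro v hv
  have h : (⟨1, 0, 0⟩ : TriangularMatrixRing B M A) • v = v := by
    ext
    · simp [zero_bimodTmul]
    · have h0 : v.y = 0 := hv
      simp [h0]
  rw [← h]
  exact Submodule.smul_mem_smul rfl trivial

theorem TripleModule.ker_toCoker_le :
    LinearMap.ker (toCoker φ) ≤ RingHom.ker (toB : TriangularMatrixRing B M A →+* B) • (⊤ :
      Submodule (TriangularMatrixRing B M A) (TripleModule φ)) := by
  intro v hv
  have h1 : ∀ t, (⟨φ t, 0⟩ : TripleModule φ) ∈
      RingHom.ker (toB : TriangularMatrixRing B M A →+* B) • (⊤ : Submodule (TriangularMatrixRing B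
        M A) (TripleModule φ)) := fun t => by
    induction t using bimodTensor_induction with
    | tmul m y =>
      have h : (⟨φ (bimodTmul B A m y), 0⟩ : TripleModule φ) =
          (⟨0, m, 0⟩ : TriangularMatrixRing B M A) • (⟨0, y⟩ : TripleModule φ) := by
        ext <;> simp
      rw [h]
      exact Submodule.smul_mem_smul rfl trivial
    | add s t hs ht =>
      have h : (⟨φ (s + t), 0⟩ : TripleModule φ) = ⟨φ s, 0⟩ + ⟨φ t, 0⟩ := by
        ext <;> simp
      rw [h]
      exact add_mem hs ht
  obtain ⟨t, ht⟩ := (Submodule.Quotient.mk_eq_zero _).1 (show (LinearMap.range φ).mkQ v.x = 0 from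
    hv)
  have h : v = ⟨φ t, 0⟩ + (⟨0, 0, 1⟩ : TriangularMatrixRing B M A) • v := by
    ext
    · simp [ht, zero_bimodTmul]
    · simp
  rw [h]
  exact add_mem (h1 t) (Submodule.smul_mem_smul rfl trivial)

theorem extVanishes_tripleModule_lower_iff {W : Type u} [AddCommGroup W] [Module A W]
    [Module (TriangularMatrixRing B M A) W] (hW : ∀ (s : TriangularMatrixRing B M A) (w : W), s • w
      = toA s • w) :
    ExtVanishes (TriangularMatrixRing B M A) (TripleModule φ) W ↔ ExtVanishes A Y W := by
  rw [extVanishes_iff_forall_upTo, extVanishes_iff_forall_upTo]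
  refine forall_congr' fun n => extVanishesUpTo_baseChange_iff toA_surjective
    (fun N _ _ => True) (fun N P _ _ _ _ _ g hg _ => ⟨trivial, ?_⟩) hW n
    (TripleModule.toLower φ) (fun y => ⟨⟨0, y⟩, rfl⟩) TripleModule.ker_toLower_le trivial
  rintro x ⟨hxg, hx⟩
  have h : ∀ x ∈ RingHom.ker (toA : TriangularMatrixRing B M A →+* A) • (⊤ : Submodule
    (TriangularMatrixRing B M A) P), (⟨1, 0, 0⟩ : TriangularMatrixRing B M A) • x = x := by
    intro x hx
    refine Submodule.smul_induction_on hx (fun t ht n _ => ?_) fun x y hx hy => ?_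
    · have ht' : t.a = 0 := ht
      rw [smul_smul]
      congr 1
      ext <;> simp [ht']
    · rw [smul_add, hx, hy]
  rw [← h x hx]
  exact Submodule.smul_mem_smul rfl hxg

section Duality

open ArtinDual

variable {k E : Type u} [CommRing k] [Algebra k A] [Algebra k B] [Module k M]
  [IsScalarTower k B M] [IsScalarTower k Aᵐᵒᵖ M] [AddCommGroup E] [Module k E]
  {ι : (k ⧸ Ring.jacobson k) →ₗ[k] E}

theorem extVanishes_tripleModule_upper_iff [IsArtinianRing k] (hE : IsInjectiveEnvelope ι)
    [Module (TriangularMatrixRing B M A) (ArtinDual k B E)]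
    (hDB : ∀ (s : TriangularMatrixRing B M A) (f : ArtinDual k B E), s • f = toB s • f)
    (H : ExtVanishes (TriangularMatrixRing B M A) (TripleModule φ) (ArtinDual k B E))
    {W : Type u} [AddCommGroup W] [Module B W]
    [Module (TriangularMatrixRing B M A) W] (hW : ∀ (s : TriangularMatrixRing B M A) (w : W), s • w
      = toB s • w) :
    ExtVanishes (TriangularMatrixRing B M A) (TripleModule φ) W ↔ ExtVanishes B (X ⧸
      LinearMap.range φ) W := by
  rw [extVanishes_iff_forall_upTo, extVanishes_iff_forall_upTo]
  refine forall_congr' fun n => extVanishesUpTo_baseChange_iff toB_surjective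
    (fun N _ _ => ExtVanishes (TriangularMatrixRing B M A) N (ArtinDual k B E))
    (fun N P _ _ _ _ _ g hg hN => ⟨?_, ?_⟩) hW n
    (TripleModule.toCoker φ) (fun c => ?_) TripleModule.ker_toCoker_le H
  · exact hN.syzygy (K := LinearMap.ker g) (LinearMap.ker g).subtype g
      Subtype.val_injective (LinearMap.exact_subtype_ker_map g) hg
  · exact ker_inf_ker_smul_top_le hE toB_surjective toB_algebraMap hDB g hg hN
  · obtain ⟨x, rfl⟩ := (LinearMap.range φ).mkQ_surjective c
    exact ⟨⟨x, 0⟩, rfl⟩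

/-- Restriction of functionals along the inclusion of `M` in the triangular matrix ring. -/
def artinDualRestrict [Module (TriangularMatrixRing B M A) (ArtinDual k M E)]
    (hDM : ∀ (s : TriangularMatrixRing B M A) (f : ArtinDual k M E), s • f = toA s • f) :
    ArtinDual k (TriangularMatrixRing B M A) E →ₗ[TriangularMatrixRing B M A] ArtinDual k M E where
  toFun f := (toLinearMap k M E).symm
    { toFun := fun m => toLinearMap k (TriangularMatrixRing B M A) E f ⟨0, m, 0⟩
      map_add' := fun m m' => by
        rw [← map_add]
        congr 1
        ext <;> simp
      map_smul' := fun c m => by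
        rw [RingHom.id_apply, ← map_smul]
        congr 1
        ext <;> simp }
  map_add' f g := rfl
  map_smul' s f := ext_toLinearMap fun m => by
    rw [RingHom.id_apply, hDM, toLinearMap_smul]
    change toLinearMap k (TriangularMatrixRing B M A) E f (⟨0, m, 0⟩ * s) = toLinearMap k
      (TriangularMatrixRing B M A) E f ⟨0, MulOpposite.op s.a • m, 0⟩
    congr 1
    ext <;> simp

theorem artinDualRestrict_apply [Module (TriangularMatrixRing B M A) (ArtinDual k M E)]
    (hDM : ∀ (s : TriangularMatrixRing B M A) (f : ArtinDual k M E), s • f = toA s • f) (f :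
      ArtinDual k (TriangularMatrixRing B M A) E) (m : M) :
    toLinearMap k M E (artinDualRestrict hDM f) m = toLinearMap k (TriangularMatrixRing B M A) E f
      ⟨0, m, 0⟩ := rfl

theorem artinDualRestrict_surjective [Module (TriangularMatrixRing B M A) (ArtinDual k M E)]
    (hDM : ∀ (s : TriangularMatrixRing B M A) (f : ArtinDual k M E), s • f = toA s • f) :
    Function.Surjective (artinDualRestrict hDM) := fun f =>
  ⟨(toLinearMap k (TriangularMatrixRing B M A) E).symm
    { toFun := fun t => toLinearMap k M E f t.m
      map_add' := fun _ _ => map_add _ _ _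
      map_smul' := fun c t => map_smul (toLinearMap k M E f) c t.m }, rfl⟩

/-- `D(B)` vanishes in `Ext` if the kernel of `D(Λ) → D(M)` does. -/
theorem extVanishes_artinDual_of_ker [Module (TriangularMatrixRing B M A) (ArtinDual k M E)]
    [Module (TriangularMatrixRing B M A) (ArtinDual k B E)]
    (hDM : ∀ (s : TriangularMatrixRing B M A) (f : ArtinDual k M E), s • f = toA s • f)
    (hDB : ∀ (s : TriangularMatrixRing B M A) (f : ArtinDual k B E), s • f = toB s • f)
    {N : Type u} [AddCommGroup N] [Module (TriangularMatrixRing B M A) N]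
    (H : ExtVanishes (TriangularMatrixRing B M A) N (LinearMap.ker (artinDualRestrict (B := B) (A
      := A) hDM))) :
    ExtVanishes (TriangularMatrixRing B M A) N (ArtinDual k B E) := by
  let s : ArtinDual k B E →ₗ[TriangularMatrixRing B M A] ArtinDual k (TriangularMatrixRing B M A) E
    :=
    { toFun := fun f => (toLinearMap k (TriangularMatrixRing B M A) E).symm
        { toFun := fun t => toLinearMap k B E f t.b
          map_add' := fun _ _ => map_add _ _ _
          map_smul' := fun c t => map_smul (toLinearMap k B E f) c t.b }
      map_add' := fun f g => rfl
      map_smul' := fun s f => by rw [hDB]; rfl }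
  let r : ArtinDual k (TriangularMatrixRing B M A) E →+ ArtinDual k B E :=
    { toFun := fun f => (toLinearMap k B E).symm
        { toFun := fun b => toLinearMap k (TriangularMatrixRing B M A) E f ⟨b, 0, 0⟩
          map_add' := fun b b' => by
            rw [← map_add]
            congr 1
            ext <;> simp
          map_smul' := fun c b => by
            rw [RingHom.id_apply, ← map_smul]
            congr 1
            ext <;> simp }
      map_zero' := rfl
      map_add' := fun f g => rfl }
  refine H.of_retract
    (s.codRestrict _ fun f => ext_toLinearMap fun m => map_zero (toLinearMap k B E f))
    { toFun := fun u => r u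
      map_add' := fun u v => map_add r _ _
      map_smul' := fun t u => ext_toLinearMap fun b => ?_ } fun f => rfl
  have hu : toLinearMap k (TriangularMatrixRing B M A) E u ⟨0, b • t.m, 0⟩ = 0 :=
    congrArg (fun f => toLinearMap k M E f (b • t.m)) (LinearMap.mem_ker.1 u.2)
  rw [RingHom.id_apply, hDB, toLinearMap_smul]
  change toLinearMap k (TriangularMatrixRing B M A) E u (⟨b, 0, 0⟩ * t) = toLinearMap k
    (TriangularMatrixRing B M A) E u ⟨b * t.b, 0, 0⟩
  have ht : (⟨b, 0, 0⟩ * t : TriangularMatrixRing B M A) = ⟨b * t.b, 0, 0⟩ + ⟨0, b • t.m, 0⟩ := by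
    ext <;> simp
  rw [ht, map_add, hu, add_zero]

/-- If `φ` is a monomorphism and `Ext_A(Y, D(M)) = 0`, then `Ext_Λ((X, Y, φ), D(B)) = 0`. -/
theorem extVanishes_tripleModule_artinDual [IsArtinianRing k] (hE : IsInjectiveEnvelope ι)
    [Module (TriangularMatrixRing B M A) (ArtinDual k M E)] [Module (TriangularMatrixRing B M A)
      (ArtinDual k B E)]
    (hDM : ∀ (s : TriangularMatrixRing B M A) (f : ArtinDual k M E), s • f = toA s • f)
    (hDB : ∀ (s : TriangularMatrixRing B M A) (f : ArtinDual k B E), s • f = toB s • f)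
    (hφ : Function.Injective φ) (hY : ExtVanishes A Y (ArtinDual k M E)) :
    ExtVanishes (TriangularMatrixRing B M A) (TripleModule φ) (ArtinDual k B E) := by
  have := hE.injective_module
  have : Module.Injective (TriangularMatrixRing B M A) (ArtinDual k (TriangularMatrixRing B M A) E)
    := artinDual_self_injective (TriangularMatrixRing B M A)
  refine extVanishes_artinDual_of_ker hDM hDB (ExtVanishes.of_submodule
    (LinearMap.ker (artinDualRestrict hDM)).subtype (artinDualRestrict hDM) Subtype.val_injective
    (LinearMap.exact_subtype_ker_map _) (artinDualRestrict_surjective hDM)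
    extVanishes_of_injective ((extVanishes_tripleModule_lower_iff hDM).2 hY) fun h => ?_)
  have hx : ∀ x : X, h ⟨x, 0⟩ = 0 := fun x => by
    have h1 : (⟨x, 0⟩ : TripleModule φ) = (⟨1, 0, 0⟩ : TriangularMatrixRing B M A) • ⟨x, 0⟩ := by
      ext <;> simp [bimodTmul_zero]
    rw [h1, map_smul, hDM, toA_apply, zero_smul]
  let γ : Y →ₗ[A] ArtinDual k M E :=
    { toFun := fun y => h ⟨0, y⟩
      map_add' := fun y y' => by
        rw [← map_add]
        congr 1
        ext <;> simp
      map_smul' := fun a y => by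
        have h1 : (⟨0, a • y⟩ : TripleModule φ) = (⟨0, 0, a⟩ : TriangularMatrixRing B M A) • ⟨0, y⟩
          := by
          ext <;> simp [zero_bimodTmul]
        rw [h1, map_smul, hDM, toA_apply, RingHom.id_apply] }
  obtain ⟨l, hl⟩ := exists_functional_bimodTensor (B := B) γ
  let _ : Module k X := Module.compHom X (algebraMap k B)
  let φ' : BimodTensor B M A Y →ₗ[k] X :=
    { φ with
      map_smul' := fun c t => by
        change φ (c • t) = algebraMap k B c • φ t
        rw [← map_smul, algebraMap_smul] }
  obtain ⟨μ, hμ⟩ := Module.Injective.out φ' hφ l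
  have hμs : ∀ (c : k) (x : X), μ (algebraMap k B c • x) = c • μ x := fun c x => map_smul μ c x
  let G : TripleModule φ →ₗ[TriangularMatrixRing B M A] ArtinDual k (TriangularMatrixRing B M A) E
    :=
    { toFun := fun v => (toLinearMap k (TriangularMatrixRing B M A) E).symm
        { toFun := fun t => μ (t • v).x
          map_add' := fun s t => by rw [add_smul, TripleModule.add_x, map_add]
          map_smul' := fun c t => by
            rw [Algebra.smul_def, mul_smul, RingHom.id_apply, ← hμs]
            congr 1
            change algebraMap k B c • (t • v).x + φ (bimodTmul B A 0 (t • v).y) = _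
            rw [zero_bimodTmul, map_zero, add_zero] }
      map_add' := fun v w => ext_toLinearMap fun t => by
        rw [map_add]
        change μ (t • (v + w)).x = μ (t • v).x + μ (t • w).x
        rw [smul_add, TripleModule.add_x, map_add]
      map_smul' := fun s v => ext_toLinearMap fun t => by
        rw [RingHom.id_apply, toLinearMap_smul]
        change μ (t • s • v).x = μ ((t * s) • v).x
        rw [mul_smul] }
  refine ⟨G, LinearMap.ext fun v => ext_toLinearMap fun m => ?_⟩
  rw [LinearMap.comp_apply, artinDualRestrict_apply]
  have h1 : v = ⟨v.x, 0⟩ + ⟨0, v.y⟩ := by ext <;> simp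
  have h2 : h v = γ v.y := by
    conv_lhs => rw [h1, map_add, hx, zero_add]
    rfl
  rw [h2, ← hl, ← hμ]
  change μ ((⟨0, m, 0⟩ : TriangularMatrixRing B M A) • v).x = μ (φ (bimodTmul B A m v.y))
  rw [TripleModule.smul_x, zero_smul, zero_add]

/-- If all maps from `Y` to `D(M)` extend to a finitely generated projective module containing
`Y` and all maps from `Y` to `A` lift to maps from `(X, Y, φ)` to `Λ`, then `φ` is a
monomorphism. -/
theorem injective_of_extVanishes_upper [IsArtinianRing k] (hE : IsInjectiveEnvelope ι)
    [Module (TriangularMatrixRing B M A) A] [Module (TriangularMatrixRing B M A) B] [Module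
      (TriangularMatrixRing B M A) M] (hA : ∀ (s : TriangularMatrixRing B M A) (a : A), s • a = toA
        s • a)
    (hB : ∀ (s : TriangularMatrixRing B M A) (b : B), s • b = toB s • b) (hM : ∀ (s :
      TriangularMatrixRing B M A) (m : M), s • m = toB s • m)
    (H : ExtVanishes (TriangularMatrixRing B M A) (TripleModule φ) (B × M))
    {P : Type u} [AddCommGroup P] [Module A P] [Module.Finite A P] [Module.Projective A P]
    (j : Y →ₗ[A] P)
    (hj : ∀ γ : Y →ₗ[A] ArtinDual k M E, ∃ γ' : P →ₗ[A] ArtinDual k M E, γ' ∘ₗ j = γ) :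
    Function.Injective φ := by
  rw [← LinearMap.ker_eq_bot, LinearMap.ker_eq_bot']
  intro t ht
  by_contra ht0
  obtain ⟨l, hl⟩ := hE.exists_linearMap_apply_ne_zero ht0
  obtain ⟨γ', hγ'⟩ := hj (bimodTensorCurry l)
  obtain ⟨n, f, g, -, -, hfg⟩ := Module.Finite.exists_comp_eq_id_of_projective A P
  have hlift : ∀ i, ∃ F : TripleModule φ →ₗ[TriangularMatrixRing B M A] TriangularMatrixRing B M A,
    ∀ v, (F v).a = g (j v.y) i := fun i => by
    obtain ⟨F, hF⟩ := H.exists_lift (upperInclusion hB hM) (lowerProjection hA)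
      (upperInclusion_injective hB hM) (exact_upperInclusion_lowerProjection hB hM hA)
      (lowerProjection_surjective hA)
      { toFun := fun v => g (j v.y) i
        map_add' := fun v w => by simp
        map_smul' := fun s v => by simp [hA] }
    exact ⟨F, fun v => LinearMap.congr_fun hF v⟩
  choose F hF using hlift
  let d : Fin n → ArtinDual k M E := fun i => (γ' ∘ₗ f) fun i' => if i = i' then 1 else 0
  have hγ : ∀ y, bimodTensorCurry l y = ∑ i, g (j y) i • d i := fun y => by
    rw [← hγ', ← LinearMap.pi_apply_eq_sum_univ (γ' ∘ₗ f) (g (j y)), LinearMap.comp_apply,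
      LinearMap.comp_apply]
    exact congrArg γ' (LinearMap.congr_fun hfg (j y)).symm
  have hsum : ∀ t, l t = ∑ i, toLinearMap k M E (d i) (F i ⟨φ t, 0⟩).m := fun t => by
    induction t using bimodTensor_induction with
    | tmul m y =>
      rw [← bimodTensorCurry_apply, hγ, map_sum, LinearMap.sum_apply]
      refine Finset.sum_congr rfl fun i _ => ?_
      rw [toLinearMap_smul]
      have h : (⟨φ (bimodTmul B A m y), 0⟩ : TripleModule φ) = (⟨0, m, 0⟩ : TriangularMatrixRing B
        M A) • ⟨0, y⟩ := by
        ext <;> simp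
      rw [h, map_smul (F i), smul_eq_mul, mul_m, hF, zero_smul, zero_add]
    | add s t hs ht =>
      rw [map_add, hs, ht, ← Finset.sum_add_distrib]
      refine Finset.sum_congr rfl fun i _ => ?_
      have h : (⟨φ (s + t), 0⟩ : TripleModule φ) = ⟨φ s, 0⟩ + ⟨φ t, 0⟩ := by
        ext <;> simp
      rw [h, map_add, add_m, map_add]
  refine hl ((hsum t).trans (Finset.sum_eq_zero fun i _ => ?_))
  have h : (⟨φ t, 0⟩ : TripleModule φ) = 0 := by
    rw [ht]
    rfl
  rw [h, map_zero, zero_m, map_zero]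

end Duality

end TriangularExt

theorem TripleModule.finite {A B M X Y : Type u} [Ring A] [Ring B] [AddCommGroup M] [Module B M]
    [Module Aᵐᵒᵖ M] [SMulCommClass B Aᵐᵒᵖ M] [AddCommGroup X] [Module B X] [Module.Finite B X]
    [AddCommGroup Y] [Module A Y] [Module.Finite A Y] (φ : BimodTensor B M A Y →ₗ[B] X) :
    Module.Finite (TriangularMatrixRing B M A) (TripleModule φ) := by
  obtain ⟨s, hs⟩ := Module.Finite.fg_top (R := B) (M := X)
  obtain ⟨t, ht⟩ := Module.Finite.fg_top (R := A) (M := Y)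
  let S : Set (TripleModule φ) :=
    (fun x => (⟨x, 0⟩ : TripleModule φ)) '' s ∪ (fun y => (⟨0, y⟩ : TripleModule φ)) '' t
  refine ⟨Submodule.fg_def.2 ⟨S, (s.finite_toSet.image _).union (t.finite_toSet.image _), ?_⟩⟩
  let QX : Submodule B X :=
    { carrier := {x | (⟨x, 0⟩ : TripleModule φ) ∈ Submodule.span (TriangularMatrixRing B M A) S}
      zero_mem' := zero_mem (Submodule.span (TriangularMatrixRing B M A) S)
      add_mem' := fun {x x'} hx hx' => by
        have h : (⟨x + x', 0⟩ : TripleModule φ) = ⟨x, 0⟩ + ⟨x', 0⟩ := by ext <;> simp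
        rw [Set.mem_ofPred_eq, h]
        exact add_mem hx hx'
      smul_mem' := fun b x hx => by
        have h : (⟨b • x, 0⟩ : TripleModule φ) = (⟨b, 0, 0⟩ : TriangularMatrixRing B M A) • ⟨x, 0⟩ := by
          ext <;> simp [bimodTmul_zero]
        rw [Set.mem_ofPred_eq, h]
        exact Submodule.smul_mem _ _ hx }
  let QY : Submodule A Y :=
    { carrier := {y | (⟨0, y⟩ : TripleModule φ) ∈ Submodule.span (TriangularMatrixRing B M A) S}
      zero_mem' := zero_mem (Submodule.span (TriangularMatrixRing B M A) S)
      add_mem' := fun {y y'} hy hy' => by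
        have h : (⟨0, y + y'⟩ : TripleModule φ) = ⟨0, y⟩ + ⟨0, y'⟩ := by ext <;> simp
        rw [Set.mem_ofPred_eq, h]
        exact add_mem hy hy'
      smul_mem' := fun a y hy => by
        have h : (⟨0, a • y⟩ : TripleModule φ) = (⟨0, 0, a⟩ : TriangularMatrixRing B M A) • ⟨0, y⟩ := by
          ext <;> simp [zero_bimodTmul]
        rw [Set.mem_ofPred_eq, h]
        exact Submodule.smul_mem _ _ hy }
  have hX : (⊤ : Submodule B X) ≤ QX := by
    rw [← hs, Submodule.span_le]
    exact fun x hx => Submodule.subset_span (Or.inl ⟨x, hx, rfl⟩)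
  have hY : (⊤ : Submodule A Y) ≤ QY := by
    rw [← ht, Submodule.span_le]
    exact fun y hy => Submodule.subset_span (Or.inr ⟨y, hy, rfl⟩)
  refine eq_top_iff.2 fun v _ => ?_
  have h : v = ⟨v.x, 0⟩ + ⟨0, v.y⟩ := by ext <;> simp
  rw [h]
  exact add_mem (hX (x := v.x) trivial) (hY (x := v.y) trivial)

theorem isSemiGorensteinProjective_iff {R X : Type u} [Ring R] [AddCommGroup X] [Module R X] :
    IsSemiGorensteinProjective R X ↔ Module.Finite R X ∧ ExtVanishes R X R := Iff.rfl

/-- The complete projective resolution obtained by renumbering. -/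
def CompleteProjectiveResolution.shift {R : Type u} [Ring R] (T : CompleteProjectiveResolution R) :
    CompleteProjectiveResolution R where
  P i := T.P (i + 1)
  d i := T.d (i + 1)
  finite i := T.finite (i + 1)
  projective i := T.projective (i + 1)
  exact i := T.exact (i + 1)
  hom_exact i := T.hom_exact (i + 1)

/-- A Gorenstein-projective module is a submodule of a finitely generated projective module with
Gorenstein-projective quotient. -/
theorem IsGorensteinProjective.exists_embedding {R G : Type u} [Ring R] [AddCommGroup G]
    [Module R G] (h : IsGorensteinProjective R G) :
    ∃ (P G' : Type u) (_ : AddCommGroup P) (_ : Module R P) (_ : AddCommGroup G')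
      (_ : Module R G') (j : G →ₗ[R] P) (p : P →ₗ[R] G'), Module.Finite R P ∧
      Module.Projective R P ∧ IsGorensteinProjective R G' ∧ Function.Injective j ∧
      Function.Exact j p ∧ Function.Surjective p := by
  obtain ⟨T, ⟨e⟩⟩ := h
  refine ⟨T.P 0, LinearMap.ker (T.shift.d 0), _, _, _, _,
    (LinearMap.ker (T.d 0)).subtype ∘ₗ e.toLinearMap,
    (T.d 0).codRestrict (LinearMap.ker (T.d (0 + 1))) fun x => (T.exact 0 _).2 ⟨x, rfl⟩,
    T.finite 0, T.projective 0, ⟨T.shift, ⟨LinearEquiv.refl _ _⟩⟩,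
    Subtype.val_injective.comp e.injective, fun x => ⟨fun hx => ?_, ?_⟩, fun x => ?_⟩
  · exact ⟨e.symm ⟨x, congrArg Subtype.val hx⟩,
      congrArg Subtype.val (e.apply_symm_apply ⟨x, congrArg Subtype.val hx⟩)⟩
  · rintro ⟨y, rfl⟩
    exact Subtype.ext (e y).2
  · obtain ⟨y, hy⟩ := (T.exact 0 x.1).1 x.2
    exact ⟨y, Subtype.ext hy⟩

theorem mainTheorem6
    -- `k` is a commutative artinian ring, `A` and `B` are artin `k`-algebras
    (k A B M : Type u) [CommRing k] [IsArtinianRing k]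
    [Ring A] [Algebra k A] [Module.Finite k A]
    [Ring B] [Algebra k B] [Module.Finite k B]
    -- `M` is a finitely generated `B`-`A`-bimodule on which `k` acts centrally, so that the
    -- triangular matrix ring is an artin `k`-algebra
    [AddCommGroup M] [Module k M] [Module B M] [Module Aᵐᵒᵖ M]
    [SMulCommClass B Aᵐᵒᵖ M] [IsScalarTower k B M] [IsScalarTower k Aᵐᵒᵖ M]
    [Module.Finite k M]
    -- `E` is the injective envelope of `k / rad k`, which defines the duality `D = Hom_k(-, E)`
    (E : Type u) [AddCommGroup E] [Module k E]
    (ι : (k ⧸ Ring.jacobson k) →ₗ[k] E) (hE : IsInjectiveEnvelope ι)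
    (hA : IsLeftWeaklyGorenstein A) (hB : IsLeftWeaklyGorenstein B)
    (hpd : CategoryTheory.projectiveDimension (ModuleCat.of B M) < ⊤)
    (hD : InRightPerpOfSemiGorensteinProjective A (ArtinDual k M E))
    (X Y : Type u) [AddCommGroup X] [Module B X] [Module.Finite B X]
    [AddCommGroup Y] [Module A Y] [Module.Finite A Y]
    (φ : BimodTensor B M A Y →ₗ[B] X) :
    IsSemiGorensteinProjective (TriangularMatrixRing B M A) (TripleModule φ) ↔
      Function.Injective φ ∧ IsGorensteinProjective B (X ⧸ LinearMap.range φ) ∧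
        IsGorensteinProjective A Y := by
  have : IsNoetherianRing A := IsNoetherianRing.of_finite k A
  have : IsNoetherianRing B := IsNoetherianRing.of_finite k B
  have : Module.Finite B M := Module.Finite.of_restrictScalars_finite k B M
  let _ : Module (TriangularMatrixRing B M A) B :=
    Module.compHom B (TriangularMatrixRing.toB : TriangularMatrixRing B M A →+* B)
  let _ : Module (TriangularMatrixRing B M A) M :=
    Module.compHom M (TriangularMatrixRing.toB : TriangularMatrixRing B M A →+* B)
  let _ : Module (TriangularMatrixRing B M A) A :=
    Module.compHom A (TriangularMatrixRing.toA : TriangularMatrixRing B M A →+* A)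
  let _ : Module (TriangularMatrixRing B M A) (ArtinDual k B E) :=
    Module.compHom _ (TriangularMatrixRing.toB : TriangularMatrixRing B M A →+* B)
  let _ : Module (TriangularMatrixRing B M A) (ArtinDual k M E) :=
    Module.compHom _ (TriangularMatrixRing.toA : TriangularMatrixRing B M A →+* A)
  have hmA : ∀ (s : TriangularMatrixRing B M A) (a : A), s • a = s.toA • a := fun _ _ => rfl
  have hmB : ∀ (s : TriangularMatrixRing B M A) (b : B), s • b = s.toB • b := fun _ _ => rfl
  have hmM : ∀ (s : TriangularMatrixRing B M A) (m : M), s • m = s.toB • m := fun _ _ => rfl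
  have hDB : ∀ (s : TriangularMatrixRing B M A) (f : ArtinDual k B E), s • f = s.toB • f :=
    fun _ _ => rfl
  have hDM : ∀ (s : TriangularMatrixRing B M A) (f : ArtinDual k M E), s • f = s.toA • f :=
    fun _ _ => rfl
  have hinj := TriangularMatrixRing.upperInclusion_injective hmB hmM
  have hexact := TriangularMatrixRing.exact_upperInclusion_lowerProjection hmB hmM hmA
  have hsurj := TriangularMatrixRing.lowerProjection_surjective hmA
  rw [isSemiGorensteinProjective_iff, hB (X ⧸ LinearMap.range φ), hA Y,
    isSemiGorensteinProjective_iff, isSemiGorensteinProjective_iff]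
  constructor
  · rintro ⟨-, hZ⟩
    have hZB := extVanishes_upper_of_extVanishes_self hmB hZ
    have hZBM := extVanishes_upper_prod hmB hmM hpd hZB
    have hYA : ExtVanishes A Y A := (extVanishes_tripleModule_lower_iff hmA).1
      (ExtVanishes.of_quotient _ _ hinj hexact hsurj hZBM hZ)
    have hY : IsSemiGorensteinProjective A Y := ⟨inferInstance, hYA⟩
    obtain ⟨P, Y', _, _, _, _, j, p, _, _, hY', hj, hjp, hp⟩ := ((hA Y).2 hY).exists_embedding
    have hYD : ExtVanishes A Y' (ArtinDual k M E) := hD Y' ((hA Y').1 hY')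
    have hφ : Function.Injective φ := injective_of_extVanishes_upper hE hmA hmB hmM hZBM j
      fun γ => hYD.exists_extension j p hj hjp hp γ
    have hZD := extVanishes_tripleModule_artinDual hE hDM hDB hφ (hD Y hY)
    exact ⟨hφ, ⟨inferInstance, (extVanishes_tripleModule_upper_iff hE hDB hZD hmB).1 hZB⟩, hY⟩
  · rintro ⟨hφ, ⟨-, hC⟩, hY⟩
    have hZD := extVanishes_tripleModule_artinDual hE hDM hDB hφ (hD Y hY)
    have hZB := (extVanishes_tripleModule_upper_iff hE hDB hZD hmB).2 hC
    have hZBM := extVanishes_upper_prod hmB hmM hpd hZB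
    exact ⟨TripleModule.finite φ, ExtVanishes.of_extension _ _ hinj hexact hsurj hZBM
      ((extVanishes_tripleModule_lower_iff hmA).2 hY.2)⟩
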